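/- Let $n,s,k$ be integers with $1\le s\le n$ and $k\ge 0$. There are $n$ coupons; perform $k$ independent drawings, in each of which a set of $s$ of the $n$ coupons is drawn, each of the $\binom ns$ sets being equally likely. Let $Z_{n,s}(k)$ be the number of coupons that occur in none of the $k$ drawings, and let $$\tilde Z_{n,s}(k)=\frac{Z_{n,s}(k)-\mathbb E[Z_{n,s}(k)]}{\sqrt{\operatorname{var}(Z_{n,s}(k))}} .$$ For real random variables $X,Y$ with finite first moments let $d_W(X,Y)=\sup_h|\mathbb E[h(X)]-\mathbb E[h(Y)]|$, the supremum running over all $h:\mathbb R\to\mathbb R$ with Lipschitz constant at most one, and let $G$ be a standard Gaussian random variable. **Theorem.** Let $s\ge 1$ be an integer and $x\in\mathbb R$. There is a constant $C=C(s,x)\in(0,\infty)$ such that for every $\alpha\in(0,1)$ there is $N=N(s,x,\alpha)\in\mathbb N$ with the following property. For every $n\ge N$ and every integer $k_n\ge 0$ with $$\Big|k_n-\frac ns\,(\alpha\log n+x)\Big|<1$$ (that is, $k_n=\frac ns(\alpha\log n+x)$ if this number is an integer, and otherwise this number rounded up or down to an integer), $$d_W\big(\tilde Z_{n,s}(k_n),G\big)\le\begin{cases}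 C\,\dfrac{\sqrt{\log n}}{n^{\alpha}} & \text{if }\alpha\in(0,\tfrac13],\\[2mm] C\,n^{-\frac12(1-\alpha)} & \text{if }\alpha\in(\tfrac13,1).\end{cases}$$ -/

import Mathlib

open MeasureTheory ProbabilityTheory
open scoped ENNReal NNReal

noncomputable section

namespace CouponCollector

/-- The law of one drawing: a uniformly distributed `s`-element subset of the `n` coupons. -/
def drawLaw (n s : ℕ) : Measure (Finset (Fin n)) :=
  uniformOn {A : Finset (Fin n) | A.card = s}

/-- The law of `k` independent drawings; an outcome `ω` lists the sets `ω 0, …, ω (k - 1)`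
of coupons drawn. -/
def drawingsLaw (n s k : ℕ) : Measure (Fin k → Finset (Fin n)) :=
  Measure.pi fun _ => drawLaw n s

/-- The number of coupons that appear in none of the `k` drawings. -/
def undrawn {n k : ℕ} (ω : Fin k → Finset (Fin n)) : ℕ :=
  (Finset.univ.filter fun j : Fin n => ∀ m : Fin k, j ∉ ω m).card

/-- The random variable `Z`, the number of coupons not drawn, as a real number. -/
def Z (n k : ℕ) (ω : Fin k → Finset (Fin n)) : ℝ := (undrawn ω : ℝ)

/-- The standardisation `(Z - 𝔼 Z) / √(var Z)`. -/
def standardizedZ (n s k : ℕ) (ω : Fin k → Finset (Fin n)) : ℝ :=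
  (Z n k ω - ∫ ω', Z n k ω' ∂(drawingsLaw n s k)) / √(variance (Z n k) (drawingsLaw n s k))

/-- The Wasserstein distance `sup |∫ h dμ - ∫ h dν|` over all `h : ℝ → ℝ` with Lipschitz constant
at most one, for laws `μ`, `ν` on `ℝ` with finite first moments. The supremum is taken
in `[0, ∞]`. -/
def wassersteinDist (μ ν : Measure ℝ) : ℝ≥0∞ :=
  ⨆ (h : ℝ → ℝ) (_ : LipschitzWith 1 h), ENNReal.ofReal |∫ y, h y ∂μ - ∫ y, h y ∂ν|

end CouponCollector

end

/-! The proof is Stein's method with a size-bias coupling. Let μ be the mean of Z. Conditioning on a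
uniformly chosen coupon `i` being undrawn gives the size-biased law, E[Z F(Z)] = μ E[F(Z')]. The
conditioning is realised by exchanging `i`, in every drawing that contains it, for a uniform coupon
outside that drawing (`expect_Z_mul_comp_Z`).

The increment Z' - Z is 1 if `i` had been drawn (0 otherwise), minus the number of undrawn coupons
that come in as replacements. A replacement is undrawn with conditional probability Z/(n-s) given
the drawn sets. So, tested against functions of Z, the mean increment is the affine function 1 - bZ
plus an error ρ that only counts coinciding replacements (`expect_mul_expect_replacedZ_sub`).

Affinity serves twice. It yields var Z = μ(1 - bμ + Eρ), and it bounds the fluctuation of the mean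
increment by b times the standard deviation σ, so no conditional variance has to be estimated
(`abs_expect_sub_integral_gaussianReal_le`). As Eρ ≤ 1/n, E(Z' - Z)² ≤ 2 and bμ is small, the
distance is at most 200/√μ (`wassersteinDist_standardizedZ_le`).

For the given numbers of drawings μ is at least exp(-x-1) n^(1-α), which is the rate for α > 1/3.
For α ≤ 1/3 this rate is already below n^(-α), so one bound serves both cases. -/

namespace CouponCollector

/-! ### The Stein equation of the standard Gaussian law, with bounds on its solution. -/

section Stein

open Filter Topology Set

lemma hasDerivAt_exp_neg_sq (w : ℝ) :
    HasDerivAt (fun w : ℝ => Real.exp (-w ^ 2 / 2)) (-w * Real.exp (-w ^ 2 / 2)) w := by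
  have h1 : HasDerivAt (fun w : ℝ => -w ^ 2 / 2) (-w) w := by
    exact (((hasDerivAt_pow 2 w).neg).div_const 2).congr_deriv (by simp; ring)
  exact h1.exp.congr_deriv (by ring)

/-- A maximum principle for the operator `u ↦ u' - w u` on the half-line. -/
lemma nonneg_of_deriv_sub_mul_nonpos {u u' : ℝ → ℝ} (hu : ∀ w, 0 ≤ w → HasDerivAt u (u' w) w)
    (hle : ∀ w, 0 ≤ w → u' w - w * u w ≤ 0)
    (hlim : Tendsto (fun w => u w * Real.exp (-w ^ 2 / 2)) atTop (𝓝 0)) {w : ℝ} (hw : 0 ≤ w) :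
    0 ≤ u w := by
  have hd : ∀ y, 0 ≤ y → HasDerivAt (fun w => u w * Real.exp (-w ^ 2 / 2))
      ((u' y - y * u y) * Real.exp (-y ^ 2 / 2)) y := fun y hy => by
    exact ((hu y hy).mul (hasDerivAt_exp_neg_sq y)).congr_deriv (by ring)
  have hanti : AntitoneOn (fun w => u w * Real.exp (-w ^ 2 / 2)) (Ici 0) := by
    apply antitoneOn_of_deriv_nonpos (convex_Ici 0)
    · exact fun y hy => (hd y hy).continuousAt.continuousWithinAt
    · intro y hy
      rw [interior_Ici] at hy
      exact (hd y (le_of_lt hy)).differentiableAt.differentiableWithinAt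
    · intro y hy
      rw [interior_Ici] at hy
      rw [(hd y (le_of_lt hy)).deriv]
      exact mul_nonpos_of_nonpos_of_nonneg (hle y (le_of_lt hy)) (Real.exp_pos _).le
  have : 0 ≤ u w * Real.exp (-w ^ 2 / 2) := by
    apply le_of_tendsto hlim
    filter_upwards [eventually_ge_atTop w] with y hy
    exact hanti hw (hw.trans hy) hy
  exact nonneg_of_mul_nonneg_left this (Real.exp_pos _)

/-- The maximum principle applied to `m - g` and `m + g`: an explicit barrier `m` dominates `g`
without any estimate of Gaussian tails. -/
lemma abs_le_of_abs_deriv_sub_mul_le {g g' m m' b : ℝ → ℝ}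
    (hg : ∀ w, 0 ≤ w → HasDerivAt g (g' w) w) (hm : ∀ w, 0 ≤ w → HasDerivAt m (m' w) w)
    (hgb : ∀ w, 0 ≤ w → |g' w - w * g w| ≤ b w) (hmb : ∀ w, 0 ≤ w → m' w - w * m w ≤ -b w)
    (hg0 : Tendsto (fun w => g w * Real.exp (-w ^ 2 / 2)) atTop (𝓝 0))
    (hm0 : Tendsto (fun w => m w * Real.exp (-w ^ 2 / 2)) atTop (𝓝 0)) {w : ℝ} (hw : 0 ≤ w) :
    |g w| ≤ m w := by
  have h1 : 0 ≤ m w - g w := by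
    refine nonneg_of_deriv_sub_mul_nonpos (u := fun w => m w - g w) (u' := fun w => m' w - g' w)
      (fun w hw => (hm w hw).sub (hg w hw)) (fun w hw => ?_) ?_ hw
    · have := (abs_le.1 (hgb w hw)).1
      have := hmb w hw
      linarith
    · simpa [sub_mul] using hm0.sub hg0
  have h2 : 0 ≤ m w + g w := by
    refine nonneg_of_deriv_sub_mul_nonpos (u := fun w => m w + g w) (u' := fun w => m' w + g' w)
      (fun w hw => (hm w hw).add (hg w hw)) (fun w hw => ?_) ?_ hw
    · have := (abs_le.1 (hgb w hw)).2
      have := hmb w hw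
      linarith
    · simpa [add_mul] using hm0.add hg0
  exact abs_le.2 ⟨by linarith, by linarith⟩

/-- The two-sided version of `abs_le_of_abs_deriv_sub_mul_le`. -/
lemma abs_le_of_abs_deriv_sub_mul_le_abs {g g' m m' b : ℝ → ℝ}
    (hg : ∀ w, HasDerivAt g (g' w) w) (hm : ∀ w, 0 ≤ w → HasDerivAt m (m' w) w)
    (hgb : ∀ w, |g' w - w * g w| ≤ b |w|) (hmb : ∀ w, 0 ≤ w → m' w - w * m w ≤ -b w)
    (hg0 : Tendsto (fun w => g w * Real.exp (-w ^ 2 / 2)) atTop (𝓝 0))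
    (hg1 : Tendsto (fun w => g w * Real.exp (-w ^ 2 / 2)) atBot (𝓝 0))
    (hm0 : Tendsto (fun w => m w * Real.exp (-w ^ 2 / 2)) atTop (𝓝 0)) (w : ℝ) :
    |g w| ≤ m |w| := by
  rcases le_total 0 w with hw | hw
  · rw [abs_of_nonneg hw]
    refine abs_le_of_abs_deriv_sub_mul_le (fun w _ => hg w) hm (fun w hw => ?_) hmb hg0 hm0 hw
    simpa [abs_of_nonneg hw] using hgb w
  · rw [abs_of_nonpos hw]
    have : |g (- -w)| ≤ m (-w) := by
      refine abs_le_of_abs_deriv_sub_mul_le (g := fun w => g (-w)) (g' := fun w => -g' (-w)) (b := b)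
        (fun w _ => ?_) hm (fun w hw => ?_) hmb ?_ hm0 (neg_nonneg.2 hw)
      · exact ((hg (-w)).scomp w (hasDerivAt_neg w)).congr_deriv (by simp)
      · have := hgb (-w)
        rw [abs_neg, abs_of_nonneg hw] at this
        rw [← abs_neg]
        convert this using 2
        ring
      · simpa [Function.comp_def] using hg1.comp tendsto_neg_atTop_atBot
    simpa using this

lemma tendsto_mul_exp_neg_sq_cocompact {g : ℝ → ℝ} {c : ℝ} (hg : ∀ w, |g w| ≤ c * (1 + w ^ 2)) :
    Tendsto (fun w => g w * Real.exp (-w ^ 2 / 2)) (cocompact ℝ) (𝓝 0) := by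
  have h0 : Tendsto (fun t : ℝ => c * (1 + 2 * t) * Real.exp (-t)) atTop (𝓝 0) := by
    have h1 := Real.tendsto_pow_mul_exp_neg_atTop_nhds_zero 0
    have h2 := Real.tendsto_pow_mul_exp_neg_atTop_nhds_zero 1
    have := (h1.add (h2.const_mul 2)).const_mul c
    simp only [mul_zero, add_zero] at this
    refine this.congr fun t => ?_
    ring
  have h1 : Tendsto (fun w : ℝ => w ^ 2 / 2) (cocompact ℝ) atTop := by
    have : Tendsto (fun w : ℝ => ‖w‖ ^ 2 / 2) (cocompact ℝ) atTop :=
      ((tendsto_pow_atTop two_ne_zero).comp (tendsto_norm_cocompact_atTop (E := ℝ))).atTop_div_const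
        two_pos
    simpa using this
  refine squeeze_zero_norm (fun w => ?_) (h0.comp h1)
  simp only [Function.comp, norm_mul, Real.norm_eq_abs, Real.abs_exp]
  rw [← neg_div]
  gcongr
  exact (hg w).trans_eq (by ring)

lemma tendsto_mul_exp_neg_sq {g : ℝ → ℝ} {c : ℝ} (hg : ∀ w, |g w| ≤ c * (1 + w ^ 2)) :
    Tendsto (fun w => g w * Real.exp (-w ^ 2 / 2)) atTop (𝓝 0) ∧
      Tendsto (fun w => g w * Real.exp (-w ^ 2 / 2)) atBot (𝓝 0) := by
  have := tendsto_mul_exp_neg_sq_cocompact hg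
  exact ⟨this.mono_left atTop_le_cocompact, this.mono_left atBot_le_cocompact⟩

lemma hasDerivAt_two_div_one_add {w : ℝ} (hw : 0 ≤ w) :
    HasDerivAt (fun w : ℝ => 2 / (1 + w)) (-2 / (1 + w) ^ 2) w := by
  have h : HasDerivAt (fun w : ℝ => 1 + w) 1 w := (hasDerivAt_id w).const_add 1
  exact ((hasDerivAt_const w (2 : ℝ)).div h (by positivity)).congr_deriv (by ring)

/-- The barrier for bounded data. Its decay of order 1/w is what later keeps `w * f₁ w`, and hence
the second derivative, bounded. -/
lemma two_div_one_add_barrier {w : ℝ} (hw : 0 ≤ w) :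
    -2 / (1 + w) ^ 2 - w * (2 / (1 + w)) ≤ -1 := by
  have h : 0 < 1 + w := by positivity
  have : -2 / (1 + w) ^ 2 - w * (2 / (1 + w)) + 1 = -(1 + w ^ 2) / (1 + w) ^ 2 := by
    field_simp
    ring
  have h2 : -(1 + w ^ 2) / (1 + w) ^ 2 ≤ 0 :=
    div_nonpos_of_nonpos_of_nonneg (by nlinarith) (by positivity)
  linarith

lemma integrable_mul_exp_neg_sq {H : ℝ → ℝ} (hH : Continuous H) (hb : ∀ y, |H y| ≤ 1 + |y|) :
    Integrable fun y => H y * Real.exp (-y ^ 2 / 2) := by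
  have h1 : Integrable fun y : ℝ => Real.exp (-(1 / 2 : ℝ) * y ^ 2) :=
    integrable_exp_neg_mul_sq (by norm_num)
  have h2 : Integrable fun y : ℝ => y * Real.exp (-(1 / 2 : ℝ) * y ^ 2) :=
    integrable_mul_exp_neg_mul_sq (by norm_num)
  refine (h1.add h2.norm).mono' (by fun_prop) (ae_of_all _ fun y => ?_)
  have he : Real.exp (-y ^ 2 / 2) = Real.exp (-(1 / 2 : ℝ) * y ^ 2) := by congr 1; ring
  simp only [norm_mul, Real.norm_eq_abs, Real.abs_exp, Pi.add_apply, he]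
  have := mul_le_mul_of_nonneg_right (hb y) (Real.exp_pos (-(1 / 2 : ℝ) * y ^ 2)).le
  linarith

/-- The solution is exp(w²/2) times the integral of H(y) exp(-y²/2) over y ≤ w. Centering makes this
integral vanish at both ends, which is the growth condition of the maximum principle. The barrier 1
+ 2/(1+w) handles data of size 1 + w, and its value at 0 is the constant 3. -/
lemma exists_stein_solution_of_centered {H : ℝ → ℝ} (hH : Continuous H)
    (hb : ∀ y, |H y| ≤ 1 + |y|) (h0 : ∫ y, H y * Real.exp (-y ^ 2 / 2) = 0) :
    ∃ f : ℝ → ℝ, (∀ w, HasDerivAt f (w * f w + H w) w) ∧ ∀ w, |f w| ≤ 3 := by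
  have hint := integrable_mul_exp_neg_sq hH hb
  set G : ℝ → ℝ := fun y => H y * Real.exp (-y ^ 2 / 2) with hG
  have hGc : Continuous G := by fun_prop
  set F : ℝ → ℝ := fun w => ∫ y in Iic w, G y with hF
  have hFd : ∀ w, HasDerivAt F (G w) w := by
    intro w
    have h1 : F = fun w => F 0 + ∫ y in (0 : ℝ)..w, G y := by
      ext w
      rw [← intervalIntegral.integral_Iic_sub_Iic hint.integrableOn hint.integrableOn]
      simp [hF]
    rw [h1]
    exact ((hGc.integral_hasStrictDerivAt 0 w).hasDerivAt).const_add _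
  have htop : Tendsto F atTop (𝓝 0) := by
    rw [← h0]
    exact (aecover_Iic tendsto_id).integral_tendsto_of_countably_generated hint
  have hbot : Tendsto F atBot (𝓝 0) := by
    have h1 : F = fun w => - ∫ y in Ioi w, G y := by
      ext w
      have := integral_add_compl (measurableSet_Iic (a := w)) hint
      rw [compl_Iic, h0] at this
      simp only [hF]
      linarith
    have h2 : Tendsto (fun w => ∫ y in Ioi w, G y) atBot (𝓝 (∫ y, G y)) :=
      (aecover_Ioi tendsto_id).integral_tendsto_of_countably_generated hint
    rw [h0] at h2
    rw [h1]
    simpa using h2.neg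
  set f : ℝ → ℝ := fun w => F w * Real.exp (w ^ 2 / 2) with hf
  have hfF : ∀ w, f w * Real.exp (-w ^ 2 / 2) = F w := fun w => by
    simp only [hf, mul_assoc, ← Real.exp_add]
    ring_nf
    simp
  have hfd : ∀ w, HasDerivAt f (w * f w + H w) w := by
    intro w
    have h1 : HasDerivAt (fun w : ℝ => w ^ 2 / 2) w w := by
      exact ((hasDerivAt_pow 2 w).div_const 2).congr_deriv (by simp)
    refine ((hFd w).mul h1.exp).congr_deriv ?_
    simp only [hf, hG, mul_assoc, ← Real.exp_add]
    ring_nf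
    simp
  refine ⟨f, hfd, fun w => ?_⟩
  have key := abs_le_of_abs_deriv_sub_mul_le_abs (g := f) (g' := fun w => w * f w + H w)
    (m := fun w => 1 + 2 / (1 + w)) (m' := fun w => -2 / (1 + w) ^ 2) (b := fun w => 1 + w)
    hfd (fun w hw => (hasDerivAt_two_div_one_add hw).const_add 1) (fun w => by simpa using hb w)
    (fun w hw => by have := two_div_one_add_barrier hw; linarith)
    (htop.congr fun w => (hfF w).symm) (hbot.congr fun w => (hfF w).symm) ?_ w
  · refine key.trans ?_
    have : 2 / (1 + |w|) ≤ 2 := div_le_self zero_le_two (by simp)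
    linarith
  · have := (tendsto_mul_exp_neg_sq (g := fun w => 1 + 2 / (1 + |w|)) (c := 3) fun w => ?_).1
    · refine this.congr' ?_
      filter_upwards [eventually_ge_atTop 0] with w hw
      rw [abs_of_nonneg hw]
    · rw [abs_of_nonneg (by positivity)]
      have : 2 / (1 + |w|) ≤ 2 := div_le_self zero_le_two (by simp)
      nlinarith [sq_nonneg w]

/-- Bounds on the solution of the Stein equation for a differentiable Lipschitz function. -/
lemma exists_stein_solution_of_hasDerivAt_of_centered {H H' : ℝ → ℝ}
    (hH : ∀ y, HasDerivAt H (H' y) y) (hH' : ∀ y, |H' y| ≤ 1) (hb : ∀ y, |H y| ≤ 1 + |y|)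
    (h0 : ∫ y, H y * Real.exp (-y ^ 2 / 2) = 0) :
    ∃ f f₁ f₂ : ℝ → ℝ, (∀ w, HasDerivAt f (f₁ w) w) ∧ (∀ w, HasDerivAt f₁ (f₂ w) w) ∧
      (∀ w, f₁ w - w * f w = H w) ∧ (∀ w, |f₁ w| ≤ 8) ∧ ∀ w, |f₂ w| ≤ 12 := by
  obtain ⟨f, hfd, hfb⟩ := exists_stein_solution_of_centered
    (continuous_iff_continuousAt.2 fun y => (hH y).continuousAt) hb h0
  set f₁ : ℝ → ℝ := fun w => w * f w + H w with hf₁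
  -- The derivative `f₁` again solves a Stein equation, with data `f + H'` bounded by 3 + 1 = 4.
  -- Four times the barrier therefore bounds it by 8/(1+|w|).
  set f₂ : ℝ → ℝ := fun w => w * f₁ w + (f w + H' w) with hf₂
  have hf₁d : ∀ w, HasDerivAt f₁ (f₂ w) w := by
    intro w
    refine (((hasDerivAt_id w).mul (hfd w)).add (hH w)).congr_deriv ?_
    simp only [hf₂, hf₁, id]
    ring
  have hB : ∀ w, |f w + H' w| ≤ 4 := fun w =>
    (abs_add_le _ _).trans (by linarith [hfb w, hH' w])
  have hlim := tendsto_mul_exp_neg_sq (g := f₁) (c := 5) fun w => by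
    have h1 : |f₁ w| ≤ |w| * 3 + (1 + |w|) := by
      refine (abs_add_le _ _).trans (add_le_add ?_ (hb w))
      rw [abs_mul]
      exact mul_le_mul_of_nonneg_left (hfb w) (abs_nonneg w)
    nlinarith [sq_abs w, sq_nonneg (|w| - 1)]
  have hm0 : Tendsto (fun w : ℝ => (4 * (2 / (1 + w))) * Real.exp (-w ^ 2 / 2)) atTop (𝓝 0) := by
    have := (tendsto_mul_exp_neg_sq (g := fun w => 4 * (2 / (1 + |w|))) (c := 8) fun w => ?_).1
    · refine this.congr' ?_
      filter_upwards [eventually_ge_atTop 0] with w hw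
      rw [abs_of_nonneg hw]
    · rw [abs_of_nonneg (by positivity)]
      have : 2 / (1 + |w|) ≤ 2 := div_le_self zero_le_two (by simp)
      nlinarith [sq_nonneg w]
  have key := abs_le_of_abs_deriv_sub_mul_le_abs (g := f₁) (g' := f₂)
    (m := fun w => 4 * (2 / (1 + w))) (m' := fun w => 4 * (-2 / (1 + w) ^ 2)) (b := fun _ => 4)
    hf₁d (fun w hw => (hasDerivAt_two_div_one_add hw).const_mul 4)
    (fun w => by simpa [hf₂] using hB w)
    (fun w hw => by have := two_div_one_add_barrier hw; linarith) hlim.1 hlim.2 hm0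
  refine ⟨f, f₁, f₂, hfd, hf₁d, fun w => by simp [hf₁], fun w => (key w).trans ?_, fun w => ?_⟩
  · have : 2 / (1 + |w|) ≤ 2 := div_le_self zero_le_two (by simp)
    linarith
  · refine (abs_add_le _ _).trans ?_
    have h1 : |w * f₁ w| ≤ 8 := by
      rw [abs_mul]
      refine (mul_le_mul_of_nonneg_left (key w) (abs_nonneg w)).trans ?_
      have : |w| * (4 * (2 / (1 + |w|))) = 8 * (|w| / (1 + |w|)) := by ring
      rw [this]
      have : |w| / (1 + |w|) ≤ 1 := div_le_one_of_le₀ (by linarith) (by positivity)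
      linarith
    linarith [hB w]

lemma integral_gaussianReal_eq (g : ℝ → ℝ) :
    ∫ y, g y ∂(gaussianReal 0 1) = (√(2 * Real.pi))⁻¹ * ∫ y, g y * Real.exp (-y ^ 2 / 2) := by
  rw [integral_gaussianReal_eq_integral_smul one_ne_zero, ← integral_const_mul]
  congr 1
  ext y
  simp [gaussianPDFReal]
  ring

lemma integrable_gaussianReal_of_lipschitzWith {h : ℝ → ℝ} (hh : LipschitzWith 1 h) :
    Integrable h (gaussianReal 0 1) := by
  have h1 : Integrable (fun y : ℝ => y) (gaussianReal 0 1) :=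
    (memLp_id_gaussianReal 1).integrable le_rfl
  refine ((integrable_const |h 0|).add h1.norm).mono' hh.continuous.aestronglyMeasurable
    (ae_of_all _ fun y => ?_)
  have := hh.dist_le_mul y 0
  simp only [Real.dist_eq, NNReal.coe_one, one_mul, sub_zero] at this
  have h3 := abs_sub_abs_le_abs_sub (h y) (h 0)
  simp only [Real.norm_eq_abs, Pi.add_apply]
  linarith

lemma integral_abs_gaussianReal_le : ∫ y, |y| ∂(gaussianReal 0 1) ≤ 1 := by
  have h2 : Integrable (fun y : ℝ => y ^ 2) (gaussianReal 0 1) :=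
    (memLp_id_gaussianReal 2).integrable_sq
  have h1 : Integrable (fun y : ℝ => y) (gaussianReal 0 1) :=
    (memLp_id_gaussianReal 1).integrable le_rfl
  have hv : ∫ y, y ^ 2 ∂(gaussianReal 0 1) = 1 := by
    have := variance_of_integral_eq_zero (μ := gaussianReal 0 1) (X := fun y => y)
      (by fun_prop) integral_id_gaussianReal
    rw [← this]
    simp
  calc ∫ y, |y| ∂(gaussianReal 0 1) ≤ ∫ y, ((1 : ℝ) / 2 + y ^ 2 / 2) ∂(gaussianReal 0 1) := by
        refine integral_mono h1.norm ((integrable_const _).add (h2.div_const 2)) fun y => ?_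
        nlinarith [sq_abs y, sq_nonneg (|y| - 1)]
    _ = 1 := by
        rw [integral_add (integrable_const _) (h2.div_const 2), integral_div 2 fun y : ℝ => y ^ 2,
          hv]
        simp
        norm_num

lemma abs_sub_integral_gaussianReal_le {h : ℝ → ℝ} (hh : LipschitzWith 1 h) (x : ℝ) :
    |h x - ∫ y, h y ∂(gaussianReal 0 1)| ≤ 1 + |x| := by
  have hi := integrable_gaussianReal_of_lipschitzWith hh
  have h1 : Integrable (fun y : ℝ => |y|) (gaussianReal 0 1) :=
    ((memLp_id_gaussianReal 1).integrable le_rfl).norm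
  have h2 : h x - ∫ y, h y ∂(gaussianReal 0 1) = ∫ y, (h x - h y) ∂(gaussianReal 0 1) := by
    rw [integral_sub (integrable_const _) hi]
    simp
  rw [h2]
  calc |∫ y, (h x - h y) ∂(gaussianReal 0 1)| ≤ ∫ y, |h x - h y| ∂(gaussianReal 0 1) :=
        abs_integral_le_integral_abs
    _ ≤ ∫ y, (|x| + |y|) ∂(gaussianReal 0 1) := by
        refine integral_mono ((integrable_const _).sub hi).norm ((integrable_const _).add h1)
          fun y => ?_
        have := hh.dist_le_mul x y
        simp only [Real.dist_eq, NNReal.coe_one, one_mul] at this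
        exact this.trans (abs_sub _ _)
    _ ≤ 1 + |x| := by
        rw [integral_add (integrable_const _) h1]
        simp only [integral_const, probReal_univ, one_smul]
        linarith [integral_abs_gaussianReal_le]

/-- The Stein equation of the standard Gaussian law for a differentiable Lipschitz function. -/
theorem exists_stein_solution {h h' : ℝ → ℝ} (hh : ∀ y, HasDerivAt h (h' y) y)
    (hh' : ∀ y, |h' y| ≤ 1) :
    ∃ f f₁ f₂ : ℝ → ℝ, (∀ w, HasDerivAt f (f₁ w) w) ∧ (∀ w, HasDerivAt f₁ (f₂ w) w) ∧
      (∀ w, f₁ w - w * f w = h w - ∫ y, h y ∂(gaussianReal 0 1)) ∧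
      (∀ w, |f₁ w| ≤ 8) ∧ ∀ w, |f₂ w| ≤ 12 := by
  have hL : LipschitzWith 1 h :=
    lipschitzWith_of_nnnorm_deriv_le (fun y => (hh y).differentiableAt) fun y => by
      rw [(hh y).deriv, ← NNReal.coe_le_coe]
      simpa using hh' y
  have hi := integrable_gaussianReal_of_lipschitzWith hL
  refine exists_stein_solution_of_hasDerivAt_of_centered (fun y => (hh y).sub_const _) hh'
    (abs_sub_integral_gaussianReal_le hL) ?_
  have h1 : ∫ x, (h x - ∫ y, h y ∂(gaussianReal 0 1)) ∂(gaussianReal 0 1) = 0 := by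
    rw [integral_sub hi (integrable_const _)]
    simp
  rw [integral_gaussianReal_eq] at h1
  exact (mul_eq_zero.1 h1).resolve_left (by positivity)

/-- The mean value inequality used twice; this loses the factor 1/2 of Taylor's formula but needs no
continuity of `f₂`. -/
lemma abs_sub_sub_mul_le_of_deriv_bound {f f₁ f₂ : ℝ → ℝ} {B : ℝ}
    (hf : ∀ w, HasDerivAt f (f₁ w) w) (hf₁ : ∀ w, HasDerivAt f₁ (f₂ w) w)
    (hB : ∀ w, |f₂ w| ≤ B) (a b : ℝ) : |f b - f a - f₁ a * (b - a)| ≤ B * (b - a) ^ 2 := by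
  have h1 : ∀ x y, |f₁ y - f₁ x| ≤ B * |y - x| := fun x y =>
    convex_univ.norm_image_sub_le_of_norm_hasDerivWithin_le
      (fun z _ => (hf₁ z).hasDerivWithinAt) (fun z _ => hB z) (mem_univ x) (mem_univ y)
  have h2 := (convex_uIcc a b).norm_image_sub_le_of_norm_hasDerivWithin_le
    (f := fun y => f y - f₁ a * y) (f' := fun y => f₁ y - f₁ a * 1) (C := B * |b - a|)
    (fun z _ => ((hf z).sub ((hasDerivAt_id z).const_mul (f₁ a))).hasDerivWithinAt)
    (fun z hz => by
      rw [mul_one]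
      refine (h1 a z).trans ?_
      have h0 : 0 ≤ B := (abs_nonneg _).trans (hB 0)
      exact mul_le_mul_of_nonneg_left (abs_sub_left_of_mem_uIcc hz) h0)
    left_mem_uIcc right_mem_uIcc
  simp only [Real.norm_eq_abs] at h2
  rw [← sq_abs (b - a), pow_two, ← mul_assoc]
  convert h2 using 2
  ring

/-- A Lipschitz function is a uniform limit of differentiable Lipschitz functions. -/
lemma exists_hasDerivAt_near_lipschitzWith {h : ℝ → ℝ} (hh : LipschitzWith 1 h) {ε : ℝ}
    (hε : 0 < ε) :
    ∃ g g' : ℝ → ℝ, (∀ y, HasDerivAt g (g' y) y) ∧ (∀ y, |g' y| ≤ 1) ∧ ∀ y, |g y - h y| ≤ ε := by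
  have hc := hh.continuous
  have hl : ∀ x y, |h x - h y| ≤ |x - y| := fun x y => by
    simpa [Real.dist_eq] using hh.dist_le_mul x y
  have hii : ∀ a b, IntervalIntegrable h volume a b := fun a b => hc.intervalIntegrable a b
  -- The moving average over a window of length ε: its derivative is a difference quotient of `h`.
  refine ⟨fun x => (∫ y in x..(x + ε), h y) / ε, fun x => (h (x + ε) - h x) / ε, fun x => ?_,
    fun x => ?_, fun x => ?_⟩
  · have h1 : (fun x => ∫ y in x..(x + ε), h y) =
        fun x => (∫ y in (0 : ℝ)..(x + ε), h y) - ∫ y in (0 : ℝ)..x, h y := by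
      ext x
      rw [intervalIntegral.integral_interval_sub_left (hii _ _) (hii _ _)]
    have h2 : HasDerivAt (fun x => ∫ y in x..(x + ε), h y) (h (x + ε) - h x) x := by
      rw [h1]
      exact ((hc.integral_hasStrictDerivAt 0 (x + ε)).hasDerivAt.comp_add_const x ε).sub
        (hc.integral_hasStrictDerivAt 0 x).hasDerivAt
    exact h2.div_const ε
  · rw [abs_div, abs_of_pos hε, div_le_one hε]
    refine (hl _ _).trans ?_
    rw [add_sub_cancel_left, abs_of_pos hε]
  · have h1 : (∫ y in x..(x + ε), h y) / ε - h x = (∫ y in x..(x + ε), (h y - h x)) / ε := by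
      rw [intervalIntegral.integral_sub (hii _ _) (by simp)]
      simp
      field_simp
    rw [h1, abs_div, abs_of_pos hε, div_le_iff₀ hε]
    have := intervalIntegral.norm_integral_le_of_norm_le_const (a := x) (b := x + ε)
      (f := fun y => h y - h x) (C := ε) fun y hy => by
        rw [uIoc_of_le (by linarith)] at hy
        refine (hl _ _).trans ?_
        rw [abs_le]
        constructor <;> linarith [hy.1, hy.2]
    simpa [abs_of_pos hε] using this

end Stein

/-! ### Averages over uniform draws and their replacements. -/

section Draws

open Finset
open scoped BigOperators

/-- The sets that can be drawn. -/
def draws (n s : ℕ) : Finset (Finset (Fin n)) := univ.filter fun A => A.card = s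

/-- The sets that can be drawn and that do not contain the coupon `i`. -/
def drawsAvoiding (n s : ℕ) (i : Fin n) : Finset (Finset (Fin n)) :=
  univ.filter fun A => A.card = s ∧ i ∉ A

/-- The pairs of a set that can be drawn and a coupon outside it, the replacement. -/
def markedDraws (n s : ℕ) : Finset (Finset (Fin n) × Fin n) :=
  univ.filter fun a => a.1.card = s ∧ a.2 ∉ a.1

/-- The sequences of `k` elements of `T`. -/
abbrev seqs {α : Type*} (k : ℕ) (T : Finset α) : Finset (Fin k → α) :=
  Fintype.piFinset fun _ => T

/-- The drawn sets of a sequence of marked draws. -/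
def drawnSets {n k : ℕ} (τ : Fin k → Finset (Fin n) × Fin n) : Fin k → Finset (Fin n) :=
  fun m => (τ m).1

/-- The set drawn after the coupon `i` has been exchanged for the replacement. -/
def replaceCoupon {n : ℕ} (i : Fin n) (a : Finset (Fin n) × Fin n) : Finset (Fin n) :=
  if i ∈ a.1 then insert a.2 (a.1.erase i) else a.1

/-- The set of coupons that appear in none of the drawings. -/
def undrawnSet {n k : ℕ} (ω : Fin k → Finset (Fin n)) : Finset (Fin n) :=
  univ.filter fun j => ∀ m, j ∉ ω m

lemma mem_undrawnSet {n k : ℕ} {ω : Fin k → Finset (Fin n)} {j : Fin n} :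
    j ∈ undrawnSet ω ↔ ∀ m, j ∉ ω m := by
  simp [undrawnSet]

lemma Z_eq_card {n k : ℕ} (ω : Fin k → Finset (Fin n)) : Z n k ω = ((undrawnSet ω).card : ℝ) := rfl

lemma card_seqs {α : Type*} (k : ℕ) (T : Finset α) : (seqs k T).card = T.card ^ k := by
  simp [seqs]

/-- A map with fibres of constant size carries uniform sequences to uniform sequences. -/
lemma expect_seqs_comp {α β : Type*} [DecidableEq α] [DecidableEq β] {T : Finset α} {S : Finset β}
    {r : α → β} {N k : ℕ} (hN : N ≠ 0) (hr : ∀ a ∈ T, r a ∈ S)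
    (hc : ∀ b ∈ S, (T.filter fun a => r a = b).card = N) (Φ : (Fin k → β) → ℝ) :
    𝔼 τ ∈ seqs k T, Φ (fun m => r (τ m)) = 𝔼 ω ∈ seqs k S, Φ ω := by
  have hT : T.card = N * S.card := by
    rw [card_eq_sum_card_fiberwise (f := r) (t := S) fun a ha => hr a ha, sum_congr rfl hc]
    simp [mul_comm]
  have hsum : ∑ τ ∈ seqs k T, Φ (fun m => r (τ m)) = (N : ℝ) ^ k * ∑ ω ∈ seqs k S, Φ ω := by
    rw [← sum_fiberwise_of_maps_to (s := seqs k T) (t := seqs k S) (g := fun τ m => r (τ m))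
      (fun τ hτ => by
        simp only [seqs, Fintype.mem_piFinset] at hτ ⊢
        exact fun m => hr _ (hτ m)), mul_sum]
    refine sum_congr rfl fun ω hω => ?_
    have h1 : ((seqs k T).filter fun τ => (fun m => r (τ m)) = ω) =
        Fintype.piFinset fun m => T.filter fun a => r a = ω m := by
      ext τ
      simp only [seqs, mem_filter, Fintype.mem_piFinset, funext_iff]
      exact ⟨fun h m => ⟨h.1 m, h.2 m⟩, fun h => ⟨fun m => (h m).1, fun m => (h m).2⟩⟩
    rw [sum_congr rfl (g := fun _ => Φ ω) fun τ hτ => by rw [(mem_filter.1 hτ).2], sum_const, h1,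
      Fintype.card_piFinset, prod_congr rfl (g := fun _ => N) fun m _ =>
        hc _ (Fintype.mem_piFinset.1 hω m)]
    simp
  rw [expect_eq_sum_div_card, expect_eq_sum_div_card, hsum, card_seqs, card_seqs, hT]
  push_cast
  rw [mul_pow, mul_div_mul_left]
  positivity

/-- The replacement `c` determines the preimage: if `c ∉ B`, the draw was `B` and nothing was
exchanged; if `c ∈ B`, then `c` came in for `i`. So there is one preimage for each of the `n`
coupons. -/
lemma card_filter_replaceCoupon {n s : ℕ} (i : Fin n) {B : Finset (Fin n)}
    (hB : B ∈ drawsAvoiding n s i) :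
    ((markedDraws n s).filter fun a => replaceCoupon i a = B).card = n := by
  simp only [drawsAvoiding, mem_filter, mem_univ, true_and] at hB
  obtain ⟨hBs, hiB⟩ := hB
  have : ((markedDraws n s).filter fun a => replaceCoupon i a = B) =
      univ.image fun c : Fin n => if c ∈ B then (insert i (B.erase c), c) else (B, c) := by
    ext ⟨A, c⟩
    simp only [markedDraws, mem_filter, mem_univ, true_and, mem_image]
    unfold replaceCoupon
    constructor
    · rintro ⟨⟨hA, hc⟩, h⟩
      refine ⟨c, ?_⟩
      split_ifs at h with hi
      · have hcB : c ∈ B := by rw [← h]; exact mem_insert_self _ _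
        rw [if_pos hcB, ← h, erase_insert (by simp [hc]), insert_erase hi]
      · obtain rfl : A = B := h
        rw [if_neg hc]
    · rintro ⟨d, hd⟩
      split_ifs at hd with hdB
      · simp only [Prod.mk.injEq] at hd
        obtain ⟨rfl, rfl⟩ := hd
        have hdi : d ≠ i := fun h => hiB (h ▸ hdB)
        have hi' : i ∉ B.erase d := by simp [hiB]
        refine ⟨⟨?_, ?_⟩, ?_⟩
        · rw [card_insert_of_notMem hi', card_erase_add_one hdB, hBs]
        · simp [hdi]
        · rw [if_pos (mem_insert_self _ _), erase_insert hi', insert_erase hdB]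
      · simp only [Prod.mk.injEq] at hd
        obtain ⟨rfl, rfl⟩ := hd
        exact ⟨⟨hBs, hdB⟩, by rw [if_neg hiB]⟩
  rw [this, card_image_of_injective, card_univ, Fintype.card_fin]
  intro c d hcd
  have := congrArg Prod.snd hcd
  simp only at this
  split_ifs at this <;> exact this

lemma card_filter_fst {n s : ℕ} {A : Finset (Fin n)} (hA : A ∈ draws n s) {U : Finset (Fin n)}
    (hU : U ⊆ Aᶜ) :
    ((markedDraws n s).filter fun a => a.1 = A ∧ a.2 ∈ U).card = U.card := by
  simp only [draws, mem_filter, mem_univ, true_and] at hA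
  have : ((markedDraws n s).filter fun a => a.1 = A ∧ a.2 ∈ U) = U.image fun c => (A, c) := by
    ext ⟨B, c⟩
    simp only [markedDraws, mem_filter, mem_univ, true_and, mem_image, Prod.mk.injEq]
    constructor
    · rintro ⟨-, rfl, hc⟩
      exact ⟨c, hc, rfl, rfl⟩
    · rintro ⟨d, hd, rfl, rfl⟩
      exact ⟨⟨hA, by simpa using hU hd⟩, rfl, hd⟩
  rw [this, card_image_of_injective]
  intro c d h
  exact congrArg Prod.snd h

lemma fst_mem_draws {n s : ℕ} {a : Finset (Fin n) × Fin n} (ha : a ∈ markedDraws n s) :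
    a.1 ∈ draws n s := by
  simp only [markedDraws, draws, mem_filter, mem_univ, true_and] at ha ⊢
  exact ha.1

lemma replaceCoupon_mem {n s : ℕ} (i : Fin n) {a : Finset (Fin n) × Fin n}
    (ha : a ∈ markedDraws n s) : replaceCoupon i a ∈ drawsAvoiding n s i := by
  simp only [markedDraws, drawsAvoiding, replaceCoupon, mem_filter, mem_univ, true_and] at ha ⊢
  split_ifs with hi
  · refine ⟨?_, ?_⟩
    · rw [card_insert_of_notMem (by simp [ha.2]), card_erase_add_one hi, ha.1]
    · have : i ≠ a.2 := fun h => ha.2 (h ▸ hi)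
      simp [this]
  · exact ⟨ha.1, hi⟩

lemma card_compl_of_mem_draws {n s : ℕ} {A : Finset (Fin n)} (hA : A ∈ draws n s) :
    Aᶜ.card = n - s := by
  simp only [draws, mem_filter, mem_univ, true_and] at hA
  rw [card_compl, Fintype.card_fin, hA]

lemma card_markedDraws (n s : ℕ) :
    (markedDraws n s).card = (draws n s).card * (n - s) := by
  rw [card_eq_sum_card_fiberwise (f := Prod.fst) (t := draws n s) fun a ha => fst_mem_draws ha]
  rw [sum_congr rfl (g := fun _ => n - s)]
  · simp
  · intro A hA
    rw [← card_compl_of_mem_draws hA, ← card_filter_fst hA Subset.rfl]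
    congr 1
    ext a
    simp only [mem_filter, markedDraws, mem_univ, true_and, mem_compl]
    constructor
    · rintro ⟨h, rfl⟩
      exact ⟨h, rfl, h.2⟩
    · rintro ⟨h, h1, -⟩
      exact ⟨h, h1⟩

/-- Double counting of marked draws, by drawn set and by set after the exchange; binomial
coefficients are never needed. -/
lemma card_drawsAvoiding_mul (n s : ℕ) (i : Fin n) :
    (drawsAvoiding n s i).card * n = (draws n s).card * (n - s) := by
  rw [← card_markedDraws, card_eq_sum_card_fiberwise (f := replaceCoupon i)
    (t := drawsAvoiding n s i) fun a ha => replaceCoupon_mem i ha,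
    sum_congr rfl fun B hB => card_filter_replaceCoupon i hB]
  simp

lemma draws_nonempty {n s : ℕ} (h : s ≤ n) : (draws n s).Nonempty := by
  obtain ⟨A, -, hA⟩ := exists_subset_card_eq (s := (univ : Finset (Fin n))) (n := s) (by simpa)
  exact ⟨A, by simp [draws, hA]⟩

lemma markedDraws_nonempty {n s : ℕ} (h : s < n) : (markedDraws n s).Nonempty := by
  rw [← card_pos, card_markedDraws]
  exact Nat.mul_pos (card_pos.2 (draws_nonempty h.le)) (by omega)

lemma card_drawsAvoiding_div {n s : ℕ} (h : s < n) (i : Fin n) :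
    ((drawsAvoiding n s i).card : ℝ) / (draws n s).card = ((n : ℝ) - s) / n := by
  have h1 : ((drawsAvoiding n s i).card : ℝ) * n = (draws n s).card * ((n : ℝ) - s) := by
    have := congrArg (Nat.cast (R := ℝ)) (card_drawsAvoiding_mul n s i)
    push_cast [Nat.cast_sub h.le] at this
    exact this
  have h2 : (0 : ℝ) < (draws n s).card := by exact_mod_cast card_pos.2 (draws_nonempty h.le)
  have h3 : (0 : ℝ) < n := by exact_mod_cast (Nat.zero_le _).trans_lt h
  field_simp
  linarith

lemma card_draws_filter_mem_div {n s : ℕ} (h : s < n) (i : Fin n) :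
    (((draws n s).filter fun A => i ∈ A).card : ℝ) / (draws n s).card = (s : ℝ) / n := by
  have h1 := card_filter_add_card_filter_not (s := draws n s) fun A => i ∈ A
  have h2 : (draws n s).filter (fun A => i ∉ A) = drawsAvoiding n s i := by
    ext A
    simp [draws, drawsAvoiding]
  rw [h2] at h1
  have h3 := card_drawsAvoiding_div h i
  have h4 : (0 : ℝ) < (draws n s).card := by exact_mod_cast card_pos.2 (draws_nonempty h.le)
  have h5 : (0 : ℝ) < n := by exact_mod_cast (Nat.zero_le _).trans_lt h
  have h6 := congrArg (Nat.cast (R := ℝ)) h1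
  push_cast at h6
  rw [← eq_sub_iff_add_eq] at h6
  rw [h6, sub_div, h3]
  field_simp
  ring

/-- Conditionally on the drawn sets, the replacements are independent and uniformly distributed
outside the respective sets. -/
lemma expect_ite_replacements {n s k : ℕ} (h : s < n)
    (g : (Fin k → Finset (Fin n)) → ℝ) (V : (Fin k → Finset (Fin n)) → Fin k → Finset (Fin n))
    (hV : ∀ ω m, V ω m ⊆ (ω m)ᶜ) :
    𝔼 τ ∈ seqs k (markedDraws n s),
        (if ∀ m, (τ m).2 ∈ V (drawnSets τ) m then g (drawnSets τ) else 0) =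
      𝔼 ω ∈ seqs k (draws n s), g ω * ∏ m, ((V ω m).card : ℝ) / ((n : ℝ) - s) := by
  have hsum : ∑ τ ∈ seqs k (markedDraws n s),
        (if ∀ m, (τ m).2 ∈ V (drawnSets τ) m then g (drawnSets τ) else 0) =
      ∑ ω ∈ seqs k (draws n s), g ω * ∏ m, ((V ω m).card : ℝ) := by
    rw [← sum_fiberwise_of_maps_to (s := seqs k (markedDraws n s)) (t := seqs k (draws n s))
      (g := drawnSets)
      (fun τ hτ => by
        simp only [seqs, Fintype.mem_piFinset] at hτ ⊢
        exact fun m => fst_mem_draws (hτ m))]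
    refine sum_congr rfl fun ω hω => ?_
    have h1 : (((seqs k (markedDraws n s)).filter fun τ => drawnSets τ = ω).filter
          fun τ => ∀ m, (τ m).2 ∈ V ω m) =
        Fintype.piFinset fun m => (markedDraws n s).filter fun a => a.1 = ω m ∧ a.2 ∈ V ω m := by
      ext τ
      simp only [seqs, mem_filter, Fintype.mem_piFinset, funext_iff, drawnSets]
      exact ⟨fun h m => ⟨h.1.1 m, h.1.2 m, h.2 m⟩,
        fun h => ⟨⟨fun m => (h m).1, fun m => (h m).2.1⟩, fun m => (h m).2.2⟩⟩
    rw [sum_congr rfl (g := fun τ => if ∀ m, (τ m).2 ∈ V ω m then g ω else 0) fun τ hτ => by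
      rw [(mem_filter.1 hτ).2], ← sum_filter, h1, sum_const, Fintype.card_piFinset,
      prod_congr rfl fun m _ => card_filter_fst (Fintype.mem_piFinset.1 hω m) (hV ω m)]
    simp [mul_comm]
  have hns : (0 : ℝ) < (n : ℝ) - s := sub_pos.2 (by exact_mod_cast h)
  rw [expect_eq_sum_div_card, expect_eq_sum_div_card, hsum, card_seqs, card_seqs,
    card_markedDraws]
  push_cast [Nat.cast_sub h.le]
  simp only [prod_div_distrib, prod_const, card_univ, Fintype.card_fin, ← mul_div_assoc]
  rw [← sum_div, div_div, mul_pow, mul_comm (_ ^ k)]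

lemma expect_drawnSets {n s k : ℕ} (h : s < n) (g : (Fin k → Finset (Fin n)) → ℝ) :
    𝔼 τ ∈ seqs k (markedDraws n s), g (drawnSets τ) = 𝔼 ω ∈ seqs k (draws n s), g ω := by
  have hns : (0 : ℝ) < (n : ℝ) - s := sub_pos.2 (by exact_mod_cast h)
  have := expect_ite_replacements h g (fun ω m => (ω m)ᶜ) fun _ _ => Subset.rfl
  rw [expect_congr rfl (g := fun τ => g (drawnSets τ)) fun τ hτ => if_pos fun m => ?_] at this
  · rw [this]
    refine expect_congr rfl fun ω hω => ?_
    rw [prod_congr rfl (g := fun _ => 1) fun m _ => ?_]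
    · simp
    · rw [card_compl_of_mem_draws (Fintype.mem_piFinset.1 hω m), Nat.cast_sub h.le]
      exact div_self hns.ne'
  · have := Fintype.mem_piFinset.1 hτ m
    simp only [markedDraws, mem_filter] at this
    simpa [drawnSets] using this.2.2

lemma mem_compl_of_mem_seqs {n s k : ℕ} {τ : Fin k → Finset (Fin n) × Fin n}
    (hτ : τ ∈ seqs k (markedDraws n s)) (m : Fin k) : (τ m).2 ∉ (τ m).1 := by
  have := Fintype.mem_piFinset.1 hτ m
  simp only [markedDraws, mem_filter] at this
  exact this.2.2

lemma undrawnSet_subset_compl {n k : ℕ} (ω : Fin k → Finset (Fin n)) (m : Fin k) :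
    undrawnSet ω ⊆ (ω m)ᶜ := fun j hj => by
  simpa using mem_undrawnSet.1 hj m

/-- The undrawn coupons all lie outside `ω m`, among the `n - s` candidates for the replacement.
This is the source of the linearity in `Z`. -/
lemma expect_ite_mem_undrawnSet {n s k : ℕ} (h : s < n) (g : (Fin k → Finset (Fin n)) → ℝ)
    (m : Fin k) :
    𝔼 τ ∈ seqs k (markedDraws n s),
        (if (τ m).2 ∈ undrawnSet (drawnSets τ) then g (drawnSets τ) else 0) =
      𝔼 ω ∈ seqs k (draws n s), g ω * (Z n k ω / ((n : ℝ) - s)) := by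
  have hns : (0 : ℝ) < (n : ℝ) - s := sub_pos.2 (by exact_mod_cast h)
  have := expect_ite_replacements h g
    (fun ω l => if l = m then undrawnSet ω else (ω l)ᶜ) fun ω l => by
      split_ifs
      · exact undrawnSet_subset_compl ω l
      · exact Subset.rfl
  convert this using 1
  · refine expect_congr rfl fun τ hτ => ?_
    congr 1
    rw [eq_iff_iff]
    refine ⟨fun hm l => ?_, fun hl => by simpa using hl m⟩
    split_ifs with hlm
    · rw [hlm]; exact hm
    · simpa [drawnSets] using mem_compl_of_mem_seqs hτ l
  · refine expect_congr rfl fun ω hω => ?_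
    rw [prod_eq_single m]
    · simp [Z_eq_card]
    · intro l _ hl
      rw [if_neg hl, card_compl_of_mem_draws (Fintype.mem_piFinset.1 hω l), Nat.cast_sub h.le]
      exact div_self hns.ne'
    · simp

/-- Each undrawn coupon `j` is the replacement in both drawings with conditional probability
1/(n-s)², by independence; sum over `j`. -/
lemma expect_ite_eq_mem_undrawnSet {n s k : ℕ} (h : s < n) (g : (Fin k → Finset (Fin n)) → ℝ)
    {m m' : Fin k} (hmm : m ≠ m') :
    𝔼 τ ∈ seqs k (markedDraws n s),
        (if (τ m).2 = (τ m').2 ∧ (τ m).2 ∈ undrawnSet (drawnSets τ) then g (drawnSets τ) else 0) =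
      𝔼 ω ∈ seqs k (draws n s), g ω * (Z n k ω / ((n : ℝ) - s) ^ 2) := by
  have hns : (0 : ℝ) < (n : ℝ) - s := sub_pos.2 (by exact_mod_cast h)
  have key : ∀ j : Fin n, 𝔼 τ ∈ seqs k (markedDraws n s),
        (if (τ m).2 = j ∧ (τ m').2 = j ∧ j ∈ undrawnSet (drawnSets τ) then g (drawnSets τ) else 0) =
      𝔼 ω ∈ seqs k (draws n s), g ω * ((if j ∈ undrawnSet ω then 1 else 0) / ((n : ℝ) - s) ^ 2) := by
    intro j
    have := expect_ite_replacements h g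
      (fun ω l => if l = m ∨ l = m' then undrawnSet ω ∩ {j} else (ω l)ᶜ) fun ω l => by
        split_ifs
        · exact inter_subset_left.trans (undrawnSet_subset_compl ω l)
        · exact Subset.rfl
    convert this using 1
    · refine expect_congr rfl fun τ hτ => ?_
      congr 1
      rw [eq_iff_iff]
      constructor
      · rintro ⟨h1, h2, h3⟩ l
        split_ifs with hlm
        · rcases hlm with rfl | rfl <;> simp [h1, h2, h3]
        · simpa [drawnSets] using mem_compl_of_mem_seqs hτ l
      · intro hl
        have h1 := hl m
        have h2 := hl m'
        simp only [true_or, or_true, if_true, mem_inter, mem_singleton] at h1 h2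
        exact ⟨h1.2, h2.2, h1.2 ▸ h1.1⟩
    · refine expect_congr rfl fun ω hω => ?_
      rw [prod_eq_mul m m' hmm]
      · by_cases hj : j ∈ undrawnSet ω
        · have : undrawnSet ω ∩ {j} = {j} := inter_eq_right.2 (by simpa using hj)
          simp [hj, this, pow_two]
        · have : undrawnSet ω ∩ {j} = ∅ := by
            ext x
            simp only [mem_inter, mem_singleton, notMem_empty, iff_false, not_and]
            rintro hx rfl
            exact hj hx
          simp [hj, this]
      · rintro l _ ⟨h1, h2⟩
        rw [if_neg (by tauto), card_compl_of_mem_draws (Fintype.mem_piFinset.1 hω l),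
          Nat.cast_sub h.le]
        exact div_self hns.ne'
      · simp
      · simp
  have h1 : ∀ τ : Fin k → Finset (Fin n) × Fin n,
      (if (τ m).2 = (τ m').2 ∧ (τ m).2 ∈ undrawnSet (drawnSets τ) then g (drawnSets τ) else 0) =
      ∑ j, if (τ m).2 = j ∧ (τ m').2 = j ∧ j ∈ undrawnSet (drawnSets τ) then g (drawnSets τ)
        else 0 := by
    intro τ
    rw [sum_eq_single (τ m).2]
    · simp [eq_comm]
    · intro j _ hj
      rw [if_neg]
      exact fun h => hj h.1.symm
    · simp
  rw [expect_congr rfl fun τ _ => h1 τ, expect_sum_comm, sum_congr rfl fun j _ => key j,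
    ← expect_sum_comm]
  refine expect_congr rfl fun ω _ => ?_
  rw [← mul_sum, ← sum_div, Z_eq_card]
  simp

/-- Write `Z` as a sum of indicators. The sequences that leave `i` undrawn are exactly the sequences
of draws avoiding `i`, a product set. -/
lemma expect_Z_mul {n s k : ℕ} (h : s < n) (F : (Fin k → Finset (Fin n)) → ℝ) :
    𝔼 ω ∈ seqs k (draws n s), Z n k ω * F ω =
      n * (((n : ℝ) - s) / n) ^ k * 𝔼 i : Fin n, 𝔼 ω ∈ seqs k (drawsAvoiding n s i), F ω := by
  have hn : (0 : ℝ) < n := by exact_mod_cast (Nat.zero_le _).trans_lt h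
  have hd : (0 : ℝ) < (draws n s).card := by exact_mod_cast card_pos.2 (draws_nonempty h.le)
  have hns : (0 : ℝ) < (n : ℝ) - s := sub_pos.2 (by exact_mod_cast h)
  have h1 : ∑ ω ∈ seqs k (draws n s), Z n k ω * F ω =
      ∑ i : Fin n, ∑ ω ∈ seqs k (drawsAvoiding n s i), F ω := by
    have h2 : ∀ i : Fin n, seqs k (drawsAvoiding n s i) =
        (seqs k (draws n s)).filter fun ω => i ∈ undrawnSet ω := by
      intro i
      ext ω
      simp only [seqs, mem_filter, Fintype.mem_piFinset, mem_undrawnSet, draws, drawsAvoiding,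
        mem_univ, true_and]
      exact forall_and
    simp only [h2, sum_filter]
    rw [sum_comm]
    refine sum_congr rfl fun ω _ => ?_
    rw [← sum_filter, sum_const, nsmul_eq_mul, Z_eq_card]
    congr 3
    ext i
    simp
  have h3 : ∀ i : Fin n, ((drawsAvoiding n s i).card : ℝ) = (((n : ℝ) - s) / n) * (draws n s).card :=
    fun i => by rw [← card_drawsAvoiding_div h i]; field_simp
  simp only [expect_eq_sum_div_card, h1, card_seqs, card_univ, Fintype.card_fin]
  push_cast
  simp only [h3, ← sum_div]
  rw [mul_pow]
  field_simp

lemma expect_Z {n s k : ℕ} (h : s < n) :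
    𝔼 ω ∈ seqs k (draws n s), Z n k ω = n * (((n : ℝ) - s) / n) ^ k := by
  have hn : (n : ℝ) ≠ 0 := by exact_mod_cast ((Nat.zero_le _).trans_lt h).ne'
  have hns : (0 : ℝ) < (n : ℝ) - s := sub_pos.2 (by exact_mod_cast h)
  have := expect_Z_mul (k := k) h fun _ => 1
  simp only [mul_one] at this
  rw [this]
  have : NeZero n := ⟨by exact_mod_cast hn⟩
  rw [expect_congr rfl (g := fun _ => (1 : ℝ)) fun i _ => expect_const ?_ _,
    expect_const univ_nonempty, mul_one]
  rw [← card_pos, card_seqs]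
  refine pow_pos ?_ _
  rw [Nat.pos_iff_ne_zero]
  intro h0
  have h1 := card_drawsAvoiding_div h i
  rw [h0] at h1
  have : ((n : ℝ) - s) / n ≠ 0 := div_ne_zero hns.ne' hn
  simp at h1
  exact this h1.symm

/-- The mean size of the intersection of two drawn sets, weighted by the number of coupons not
drawn. -/
lemma expect_card_inter_mul_Z_le {n s k : ℕ} (h : s < n) {m m' : Fin k} (hmm : m ≠ m') :
    𝔼 ω ∈ seqs k (draws n s), ((ω m ∩ ω m').card : ℝ) * Z n k ω ≤
      n ^ 2 * (((n : ℝ) - s) / n) ^ k * (s / ((n : ℝ) - s)) ^ 2 := by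
  have hn : (0 : ℝ) < n := by exact_mod_cast (Nat.zero_le _).trans_lt h
  have hd : (0 : ℝ) < (draws n s).card := by exact_mod_cast card_pos.2 (draws_nonempty h.le)
  have hns : (0 : ℝ) < (n : ℝ) - s := sub_pos.2 (by exact_mod_cast h)
  set q : ℝ := ((n : ℝ) - s) / n with hq
  have hqp : 0 < q := by positivity
  have h1 : ∀ ω : Fin k → Finset (Fin n), ((ω m ∩ ω m').card : ℝ) * Z n k ω =
      ∑ i : Fin n, ∑ j : Fin n, if (i ∈ ω m ∧ i ∈ ω m') ∧ j ∈ undrawnSet ω then 1 else 0 := by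
    intro ω
    have h2 : ((ω m ∩ ω m').card : ℝ) = ∑ i : Fin n, if i ∈ ω m ∧ i ∈ ω m' then 1 else 0 := by
      rw [sum_boole]
      congr 2
      ext i
      simp
    have h3 : ((undrawnSet ω).card : ℝ) = ∑ j : Fin n, if j ∈ undrawnSet ω then 1 else 0 := by
      simp
    rw [Z_eq_card, h2, h3, sum_mul_sum]
    refine sum_congr rfl fun i _ => sum_congr rfl fun j _ => ?_
    rw [ite_zero_mul_ite_zero, mul_one]
  have h2 : ∀ i j : Fin n, 𝔼 ω ∈ seqs k (draws n s),
      (if (i ∈ ω m ∧ i ∈ ω m') ∧ j ∈ undrawnSet ω then (1 : ℝ) else 0) ≤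
        q ^ k * (s / ((n : ℝ) - s)) ^ 2 := by
    intro i j
    -- At `m` and `m'` the condition that `j` is avoided is dropped. These two factors are s/n in
    -- place of (n-s)/n, whence the correction (s/(n-s))².
    have h3 : (seqs k (draws n s)).filter (fun ω => (i ∈ ω m ∧ i ∈ ω m') ∧ j ∈ undrawnSet ω) ⊆
        Fintype.piFinset fun l => if l = m ∨ l = m' then (draws n s).filter fun A => i ∈ A
          else drawsAvoiding n s j := by
      intro ω hω
      simp only [seqs, mem_filter, Fintype.mem_piFinset, mem_undrawnSet] at hω ⊢
      intro l
      split_ifs with hl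
      · rcases hl with rfl | rfl
        · exact mem_filter.2 ⟨hω.1 _, hω.2.1.1⟩
        · exact mem_filter.2 ⟨hω.1 _, hω.2.1.2⟩
      · have := hω.1 l
        simp only [draws, drawsAvoiding, mem_filter, mem_univ, true_and] at this ⊢
        exact ⟨this, hω.2.2 l⟩
    have h4 := card_le_card h3
    rw [Fintype.card_piFinset] at h4
    rw [expect_eq_sum_div_card, sum_boole, card_seqs]
    have h5 : (∏ l : Fin k, ((if l = m ∨ l = m' then (draws n s).filter fun A => i ∈ A
          else drawsAvoiding n s j).card : ℝ)) / (draws n s).card ^ k =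
        q ^ k * (s / ((n : ℝ) - s)) ^ 2 := by
      have h6 : ∀ l : Fin k, ((if l = m ∨ l = m' then (draws n s).filter fun A => i ∈ A
          else drawsAvoiding n s j).card : ℝ) / (draws n s).card =
          q * if l = m ∨ l = m' then s / ((n : ℝ) - s) else 1 := by
        intro l
        split_ifs
        · rw [card_draws_filter_mem_div h, hq]
          field_simp
        · rw [card_drawsAvoiding_div h, mul_one]
      rw [← Fin.prod_const, ← prod_div_distrib, prod_congr rfl fun l _ => h6 l, prod_mul_distrib,
        prod_eq_mul m m' hmm (f := fun l => if l = m ∨ l = m' then s / ((n : ℝ) - s) else 1)]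
      · simp [pow_two]
      · rintro l _ ⟨h1, h2⟩
        rw [if_neg (by tauto)]
      · simp
      · simp
    rw [← h5]
    push_cast
    refine div_le_div_of_nonneg_right ?_ (pow_nonneg hd.le k)
    rw [← Nat.cast_prod]
    exact Nat.cast_le.2 h4
  rw [expect_congr rfl fun ω _ => h1 ω, expect_sum_comm]
  calc _ ≤ ∑ i : Fin n, ∑ j : Fin n, q ^ k * (s / ((n : ℝ) - s)) ^ 2 := by
        refine sum_le_sum fun i _ => ?_
        rw [expect_sum_comm]
        exact sum_le_sum fun j _ => h2 i j
    _ = _ := by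
        rw [sum_const, sum_const, card_univ, Fintype.card_fin, nsmul_eq_mul, nsmul_eq_mul]
        ring

end Draws

/-! ### The size-bias coupling: mean and second moment of the increment. -/

section Replacement

open Finset
open scoped BigOperators

/-- An element inserted without a new value creates a colliding pair. Ordered pairs overcount, which
is harmless for an upper bound. -/
lemma card_le_card_image_add_card_collisions {α β : Type*} [DecidableEq α] [DecidableEq β]
    (s : Finset α) (f : α → β) :
    s.card ≤ (s.image f).card + (s.offDiag.filter fun p => f p.1 = f p.2).card := by
  induction s using Finset.induction_on with
  | empty => simp
  | insert a s ha ih =>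
    rw [card_insert_of_notMem ha, image_insert]
    have hsub : (s.offDiag.filter fun p => f p.1 = f p.2) ⊆
        (insert a s).offDiag.filter fun p => f p.1 = f p.2 :=
      filter_subset_filter _ (offDiag_mono (subset_insert a s))
    by_cases hfa : f a ∈ s.image f
    · rw [insert_eq_of_mem hfa]
      obtain ⟨b, hb, hab⟩ := mem_image.1 hfa
      have hlt : (s.offDiag.filter fun p => f p.1 = f p.2).card <
          ((insert a s).offDiag.filter fun p => f p.1 = f p.2).card := by
        refine card_lt_card ⟨hsub, fun h => ?_⟩
        have h1 : (a, b) ∈ (insert a s).offDiag.filter fun p => f p.1 = f p.2 := by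
          simp only [mem_filter, mem_offDiag, mem_insert, true_or, hb, or_true, true_and]
          exact ⟨fun h => ha (h ▸ hb), hab.symm⟩
        have h2 := (mem_filter.1 (h h1)).1
        exact ha (mem_offDiag.1 h2).1
      omega
    · rw [card_insert_of_notMem hfa]
      have := card_le_card hsub
      omega

variable {n s k : ℕ}

/-- The drawings that contain `i` and whose replacement has not been drawn. -/
def fertileDrawings (i : Fin n) (τ : Fin k → Finset (Fin n) × Fin n) : Finset (Fin k) :=
  univ.filter fun m => i ∈ (τ m).1 ∧ (τ m).2 ∈ undrawnSet (drawnSets τ)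

/-- The coupons that are drawn only after the replacement of `i`. -/
def newlyDrawn (i : Fin n) (τ : Fin k → Finset (Fin n) × Fin n) : Finset (Fin n) :=
  (fertileDrawings i τ).image fun m => (τ m).2

/-- The number of coupons that are not drawn, after the replacement of `i`. -/
def replacedZ (i : Fin n) (τ : Fin k → Finset (Fin n) × Fin n) : ℝ :=
  Z n k fun m => replaceCoupon i (τ m)

/-- Only `i` leaves any set, so no other coupon becomes undrawn; a coupon stops being undrawn
exactly when it comes in as a replacement for `i`. -/
lemma undrawnSet_replaceCoupon (i : Fin n) {τ : Fin k → Finset (Fin n) × Fin n}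
    (hτ : τ ∈ seqs k (markedDraws n s)) :
    undrawnSet (fun m => replaceCoupon i (τ m)) =
      insert i (undrawnSet (drawnSets τ) \ newlyDrawn i τ) := by
  have hc := mem_compl_of_mem_seqs hτ
  ext j
  simp only [mem_undrawnSet, mem_insert, mem_sdiff, newlyDrawn, fertileDrawings, mem_image,
    mem_filter, mem_univ, true_and, drawnSets, not_exists, not_and]
  have hr : ∀ m, j ∉ replaceCoupon i (τ m) ↔
      if i ∈ (τ m).1 then j ≠ (τ m).2 ∧ (j = i ∨ j ∉ (τ m).1) else j ∉ (τ m).1 := by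
    intro m
    unfold replaceCoupon
    split_ifs
    · simp only [mem_insert, mem_erase]
      tauto
    · rfl
  simp only [hr]
  constructor
  · intro h
    by_cases hji : j = i
    · exact Or.inl hji
    · refine Or.inr ⟨fun m => ?_, fun m hm hmj => ?_⟩
      · have := h m
        split_ifs at this with hi
        · exact this.2.resolve_left hji
        · exact this
      · have := h m
        rw [if_pos hm.1] at this
        exact this.1 hmj.symm
  · rintro (rfl | ⟨h1, h2⟩) m
    · split_ifs with hi
      · exact ⟨fun h => hc m (h ▸ hi), Or.inl rfl⟩
      · exact hi
    · split_ifs with hi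
      · refine ⟨fun h => ?_, Or.inr (h1 m)⟩
        exact h2 m ⟨hi, fun l => h ▸ h1 l⟩ h.symm
      · exact h1 m

lemma newlyDrawn_subset (i : Fin n) (τ : Fin k → Finset (Fin n) × Fin n) :
    newlyDrawn i τ ⊆ undrawnSet (drawnSets τ) := by
  intro j hj
  simp only [newlyDrawn, fertileDrawings, mem_image, mem_filter, mem_univ, true_and] at hj
  obtain ⟨m, hm, rfl⟩ := hj
  exact hm.2

lemma replacedZ_sub (i : Fin n) {τ : Fin k → Finset (Fin n) × Fin n}
    (hτ : τ ∈ seqs k (markedDraws n s)) :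
    replacedZ i τ - Z n k (drawnSets τ) =
      (1 - if i ∈ undrawnSet (drawnSets τ) then 1 else 0) - ((newlyDrawn i τ).card : ℝ) := by
  rw [replacedZ, Z_eq_card, undrawnSet_replaceCoupon i hτ, Z_eq_card]
  have h1 := card_sdiff_add_card_eq_card (newlyDrawn_subset i τ)
  have h2 := congrArg (Nat.cast (R := ℝ)) h1
  push_cast at h2
  split_ifs with hi
  · have h3 : newlyDrawn i τ = ∅ := by
      rw [newlyDrawn, image_eq_empty, fertileDrawings, filter_eq_empty_iff]
      exact fun m _ hm => mem_undrawnSet.1 hi m hm.1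
    rw [h3, sdiff_empty, insert_eq_of_mem hi]
    simp
  · rw [card_insert_of_notMem (by simp [hi])]
    push_cast
    linarith

/-- The mean excess of the number of fertile drawings over the number of newly drawn coupons. -/
noncomputable def collisionExcess (τ : Fin k → Finset (Fin n) × Fin n) : ℝ :=
  (∑ i : Fin n, (((fertileDrawings i τ).card : ℝ) - (newlyDrawn i τ).card)) / n

lemma collisionExcess_nonneg (τ : Fin k → Finset (Fin n) × Fin n) : 0 ≤ collisionExcess τ :=
  div_nonneg (sum_nonneg fun _ _ => sub_nonneg.2 (Nat.cast_le.2 card_image_le)) n.cast_nonneg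

lemma card_of_mem_seqs {τ : Fin k → Finset (Fin n) × Fin n}
    (hτ : τ ∈ seqs k (markedDraws n s)) (m : Fin k) : (drawnSets τ m).card = s := by
  have := Fintype.mem_piFinset.1 hτ m
  simp only [markedDraws, mem_filter] at this
  exact this.2.1

lemma sum_card_fertileDrawings {τ : Fin k → Finset (Fin n) × Fin n}
    (hτ : τ ∈ seqs k (markedDraws n s)) :
    ∑ i : Fin n, ((fertileDrawings i τ).card : ℝ) =
      ∑ m : Fin k, if (τ m).2 ∈ undrawnSet (drawnSets τ) then (s : ℝ) else 0 := by
  simp only [fertileDrawings, ← sum_boole]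
  rw [sum_comm]
  refine sum_congr rfl fun m _ => ?_
  split_ifs with h
  · simp only [h, and_true, sum_boole]
    rw [← card_of_mem_seqs hτ m]
    congr 2
    ext i
    simp [drawnSets]
  · simp [h]

/-- Counting fertile drawings instead of newly drawn coupons makes the sum over `i` explicit: a
drawing with undrawn replacement is fertile for exactly its `s` coupons. The discrepancy is
`collisionExcess`. -/
lemma expect_replacedZ_sub (hn : n ≠ 0) {τ : Fin k → Finset (Fin n) × Fin n}
    (hτ : τ ∈ seqs k (markedDraws n s)) :
    𝔼 i : Fin n, (replacedZ i τ - Z n k (drawnSets τ)) =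
      1 - Z n k (drawnSets τ) / n
        - (∑ m : Fin k, if (τ m).2 ∈ undrawnSet (drawnSets τ) then (s : ℝ) else 0) / n
        + collisionExcess τ := by
  have hn' : (n : ℝ) ≠ 0 := by exact_mod_cast hn
  rw [← sum_card_fertileDrawings hτ, expect_congr rfl fun i _ => replacedZ_sub i hτ,
    expect_eq_sum_div_card, collisionExcess, Z_eq_card]
  simp only [sum_sub_distrib, sum_const, card_univ, Fintype.card_fin, nsmul_eq_mul, mul_one,
    sum_boole, filter_mem_eq_inter, univ_inter]
  field_simp
  ring

lemma expect_mul_expect_replacedZ_sub (h : s < n) (g : ℝ → ℝ) :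
    𝔼 τ ∈ seqs k (markedDraws n s), g (Z n k (drawnSets τ)) *
        𝔼 i : Fin n, (replacedZ i τ - Z n k (drawnSets τ)) =
      𝔼 τ ∈ seqs k (markedDraws n s), g (Z n k (drawnSets τ)) *
        (1 - (1 / n + s * k / (n * ((n : ℝ) - s))) * Z n k (drawnSets τ) + collisionExcess τ) := by
  have hn : n ≠ 0 := by omega
  have hn' : (n : ℝ) ≠ 0 := by exact_mod_cast hn
  have hns : (0 : ℝ) < (n : ℝ) - s := sub_pos.2 (by exact_mod_cast h)
  set T := seqs k (markedDraws n s)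
  have h1 : 𝔼 τ ∈ T, (∑ m : Fin k, if (τ m).2 ∈ undrawnSet (drawnSets τ) then
        g (Z n k (drawnSets τ)) else 0) =
      𝔼 τ ∈ T, k * (g (Z n k (drawnSets τ)) * (Z n k (drawnSets τ) / ((n : ℝ) - s))) := by
    rw [expect_sum_comm, sum_congr rfl fun m _ =>
      expect_ite_mem_undrawnSet h (fun ω => g (Z n k ω)) m, sum_const, card_univ, Fintype.card_fin,
      nsmul_eq_mul, ← mul_expect,
      ← expect_drawnSets h fun ω => g (Z n k ω) * (Z n k ω / ((n : ℝ) - s))]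
  have h2 : ∀ τ ∈ T, g (Z n k (drawnSets τ)) *
        𝔼 i : Fin n, (replacedZ i τ - Z n k (drawnSets τ)) =
      g (Z n k (drawnSets τ)) * (1 - Z n k (drawnSets τ) / n + collisionExcess τ) -
        s / n * ∑ m : Fin k, if (τ m).2 ∈ undrawnSet (drawnSets τ) then
          g (Z n k (drawnSets τ)) else 0 := by
    intro τ hτ
    have h3 : g (Z n k (drawnSets τ)) *
        (∑ m : Fin k, if (τ m).2 ∈ undrawnSet (drawnSets τ) then (s : ℝ) else 0) =
        s * ∑ m : Fin k, if (τ m).2 ∈ undrawnSet (drawnSets τ) then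
          g (Z n k (drawnSets τ)) else 0 := by
      rw [mul_sum, mul_sum]
      refine sum_congr rfl fun m _ => ?_
      split_ifs <;> ring
    rw [expect_replacedZ_sub hn hτ, div_mul_eq_mul_div, ← h3]
    ring
  rw [expect_congr rfl h2, expect_sub_distrib, ← mul_expect, h1, mul_expect, ← expect_sub_distrib]
  refine expect_congr rfl fun τ _ => ?_
  field_simp
  ring

lemma sum_ite_mem_inter (A B : Finset (Fin n)) (p : Prop) [Decidable p] :
    ∑ i : Fin n, (if (i ∈ A ∧ i ∈ B) ∧ p then (1 : ℝ) else 0) =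
      if p then ((A ∩ B).card : ℝ) else 0 := by
  split_ifs with h
  · simp only [h, and_true, sum_boole]
    congr 2
    ext i
    simp
  · simp [h]

lemma collisionExcess_le (τ : Fin k → Finset (Fin n) × Fin n) :
    collisionExcess τ ≤ (∑ p ∈ (univ : Finset (Fin k)).offDiag,
      if (τ p.1).2 = (τ p.2).2 ∧ (τ p.1).2 ∈ undrawnSet (drawnSets τ) then
        ((drawnSets τ p.1 ∩ drawnSets τ p.2).card : ℝ) else 0) / n := by
  rw [collisionExcess]
  refine div_le_div_of_nonneg_right ?_ n.cast_nonneg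
  simp only [← sum_ite_mem_inter]
  rw [sum_comm]
  refine sum_le_sum fun i _ => ?_
  have h1 := card_le_card_image_add_card_collisions (fertileDrawings i τ) fun m => (τ m).2
  have h2 : (fertileDrawings i τ).offDiag.filter (fun p => (τ p.1).2 = (τ p.2).2) ⊆
      (univ : Finset (Fin k)).offDiag.filter fun p => (i ∈ drawnSets τ p.1 ∧ i ∈ drawnSets τ p.2) ∧
        (τ p.1).2 = (τ p.2).2 ∧ (τ p.1).2 ∈ undrawnSet (drawnSets τ) := by
    intro p hp
    simp only [mem_filter, mem_offDiag, fertileDrawings, mem_univ, true_and] at hp ⊢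
    exact ⟨hp.1.2.2, ⟨hp.1.1.1, hp.1.2.1.1⟩, hp.2, hp.1.1.2⟩
  have h3 := h1.trans (Nat.add_le_add_left (card_le_card h2) _)
  rw [sum_boole, sub_le_iff_le_add']
  exact_mod_cast h3

lemma sum_offDiag_le {c : ℝ} (hc : 0 ≤ c) {f : Fin k × Fin k → ℝ}
    (hf : ∀ p ∈ (univ : Finset (Fin k)).offDiag, f p ≤ c) :
    ∑ p ∈ (univ : Finset (Fin k)).offDiag, f p ≤ k ^ 2 * c := by
  refine (sum_le_card_nsmul _ _ _ hf).trans ?_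
  rw [nsmul_eq_mul]
  refine mul_le_mul_of_nonneg_right ?_ hc
  have : (univ : Finset (Fin k)).offDiag.card ≤ k ^ 2 := by
    rw [offDiag_card, card_univ, Fintype.card_fin, pow_two]
    exact Nat.sub_le _ _
  exact_mod_cast this

lemma expect_collisionExcess_le (h : s < n) :
    𝔼 τ ∈ seqs k (markedDraws n s), collisionExcess τ ≤
      k ^ 2 * (n ^ 2 * (((n : ℝ) - s) / n) ^ k * (s / ((n : ℝ) - s)) ^ 2 / ((n : ℝ) - s) ^ 2)
        / n := by
  have hns : (0 : ℝ) < (n : ℝ) - s := sub_pos.2 (by exact_mod_cast h)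
  refine (expect_le_expect fun τ _ => collisionExcess_le τ).trans ?_
  rw [← expect_div, expect_sum_comm]
  refine div_le_div_of_nonneg_right (sum_offDiag_le (by positivity) fun p hp => ?_) n.cast_nonneg
  have hp' : p.1 ≠ p.2 := by simpa using hp
  rw [expect_ite_eq_mem_undrawnSet h (fun ω => ((ω p.1 ∩ ω p.2).card : ℝ)) hp']
  simp only [← mul_div_assoc]
  rw [← expect_div]
  exact div_le_div_of_nonneg_right (expect_card_inter_mul_Z_le h hp') (by positivity)

/-- In one factor of the square, the condition that the replacement is undrawn is dropped, so that
only one replacement has to be averaged over. -/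
lemma sum_sq_card_newlyDrawn_le (τ : Fin k → Finset (Fin n) × Fin n) :
    ∑ i : Fin n, ((newlyDrawn i τ).card : ℝ) ^ 2 ≤
      ∑ m : Fin k, ∑ m' : Fin k, if (τ m).2 ∈ undrawnSet (drawnSets τ) then
        ((drawnSets τ m ∩ drawnSets τ m').card : ℝ) else 0 := by
  simp only [← sum_ite_mem_inter]
  rw [sum_congr rfl fun m _ => sum_comm, sum_comm]
  refine sum_le_sum fun i _ => ?_
  have h1 : ((newlyDrawn i τ).card : ℝ) ≤ (fertileDrawings i τ).card :=
    Nat.cast_le.2 card_image_le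
  have h2 : ((fertileDrawings i τ).card : ℝ) ≤
      ((univ.filter fun m => i ∈ drawnSets τ m).card : ℝ) := by
    refine Nat.cast_le.2 (card_le_card fun m hm => ?_)
    simp only [fertileDrawings, mem_filter, mem_univ, true_and] at hm ⊢
    exact hm.1
  calc ((newlyDrawn i τ).card : ℝ) ^ 2 ≤
        (fertileDrawings i τ).card * ((univ.filter fun m => i ∈ drawnSets τ m).card : ℝ) := by
        rw [pow_two]
        exact mul_le_mul h1 (h1.trans h2) (Nat.cast_nonneg _) (Nat.cast_nonneg _)
    _ = _ := by
        simp only [fertileDrawings, ← sum_boole]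
        rw [sum_mul_sum]
        refine sum_congr rfl fun m _ => sum_congr rfl fun m' _ => ?_
        rw [ite_zero_mul_ite_zero, mul_one]
        congr 1
        simp only [drawnSets, eq_iff_iff]
        tauto

lemma expect_sq_card_newlyDrawn_le (h : s < n) :
    𝔼 τ ∈ seqs k (markedDraws n s), ∑ i : Fin n, ((newlyDrawn i τ).card : ℝ) ^ 2 ≤
      k * (s * (n * (((n : ℝ) - s) / n) ^ k) / ((n : ℝ) - s)) +
      k ^ 2 * (n ^ 2 * (((n : ℝ) - s) / n) ^ k * (s / ((n : ℝ) - s)) ^ 2 / ((n : ℝ) - s)) := by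
  have hns : (0 : ℝ) < (n : ℝ) - s := sub_pos.2 (by exact_mod_cast h)
  refine (expect_le_expect fun τ _ => sum_sq_card_newlyDrawn_le τ).trans ?_
  simp only [← sum_product', univ_product_univ]
  rw [expect_sum_comm, ← univ_product_univ, ← diag_union_offDiag,
    sum_union (disjoint_diag_offDiag _)]
  refine add_le_add ?_ (sum_offDiag_le (by positivity) fun p hp => ?_)
  · rw [sum_diag]
    refine le_of_eq ?_
    rw [sum_congr rfl fun m _ => expect_ite_mem_undrawnSet h
      (fun ω => ((ω m ∩ ω m).card : ℝ)) m]
    rw [sum_congr rfl (g := fun _ => s * (n * (((n : ℝ) - s) / n) ^ k) / ((n : ℝ) - s))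
      fun m _ => ?_]
    · simp
    · rw [← expect_Z h, mul_expect, expect_div]
      refine expect_congr rfl fun ω hω => ?_
      have := Fintype.mem_piFinset.1 hω m
      simp only [draws, mem_filter, mem_univ, true_and] at this
      rw [inter_self, this]
      ring
  · have hp' : p.1 ≠ p.2 := by simpa using hp
    rw [expect_ite_mem_undrawnSet h (fun ω => ((ω p.1 ∩ ω p.2).card : ℝ))]
    simp only [← mul_div_assoc]
    rw [← expect_div]
    exact div_le_div_of_nonneg_right (expect_card_inter_mul_Z_le h hp') (by positivity)

lemma expect_sq_replacedZ_sub_le (h : s < n) :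
    𝔼 τ ∈ seqs k (markedDraws n s), 𝔼 i : Fin n, (replacedZ i τ - Z n k (drawnSets τ)) ^ 2 ≤
      1 + (k * (s * (n * (((n : ℝ) - s) / n) ^ k) / ((n : ℝ) - s)) +
        k ^ 2 * (n ^ 2 * (((n : ℝ) - s) / n) ^ k * (s / ((n : ℝ) - s)) ^ 2 / ((n : ℝ) - s)))
        / n := by
  have hn : (0 : ℝ) < n := by exact_mod_cast (Nat.zero_le _).trans_lt h
  have hT : (seqs k (markedDraws n s)).Nonempty := by
    rw [← card_pos, card_seqs]
    exact pow_pos (card_pos.2 (markedDraws_nonempty h)) k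
  have h1 : ∀ τ ∈ seqs k (markedDraws n s),
      𝔼 i : Fin n, (replacedZ i τ - Z n k (drawnSets τ)) ^ 2 ≤
        1 + (∑ i : Fin n, ((newlyDrawn i τ).card : ℝ) ^ 2) / n := by
    intro τ hτ
    have h2 : ∑ i : Fin n, (replacedZ i τ - Z n k (drawnSets τ)) ^ 2 ≤
        ∑ i : Fin n, (1 + ((newlyDrawn i τ).card : ℝ) ^ 2) := by
      refine sum_le_sum fun i _ => ?_
      rw [replacedZ_sub i hτ]
      have := Nat.cast_nonneg (α := ℝ) (newlyDrawn i τ).card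
      split_ifs <;> nlinarith
    rw [expect_eq_sum_div_card, card_univ, Fintype.card_fin, div_le_iff₀ hn, add_mul,
      div_mul_cancel₀ _ hn.ne']
    simpa [sum_add_distrib] using h2
  refine (expect_le_expect h1).trans ?_
  rw [expect_add_distrib, expect_const hT, ← expect_div]
  have := div_le_div_of_nonneg_right (expect_sq_card_newlyDrawn_le (k := k) h) hn.le
  linarith

/-- Replacing a uniformly chosen coupon gives the size-biased law. -/
lemma expect_Z_mul_comp_Z (h : s < n) (F : ℝ → ℝ) :
    𝔼 τ ∈ seqs k (markedDraws n s), Z n k (drawnSets τ) * F (Z n k (drawnSets τ)) =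
      n * (((n : ℝ) - s) / n) ^ k *
        𝔼 τ ∈ seqs k (markedDraws n s), 𝔼 i : Fin n, F (replacedZ i τ) := by
  rw [expect_drawnSets h fun ω => Z n k ω * F (Z n k ω), expect_Z_mul h, expect_comm]
  congr 1
  refine expect_congr rfl fun i _ => ?_
  exact (expect_seqs_comp (by omega) (fun a ha => replaceCoupon_mem i ha)
    (fun B hB => card_filter_replaceCoupon i hB) fun ω => F (Z n k ω)).symm

end Replacement

/-! ### Stein's method for an abstract size-bias coupling with affine mean increment. -/

section SizeBias

open Finset
open scoped BigOperators

variable {ι κ : Type*} {Ω : Finset ι} {J : Finset κ}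

lemma expect_abs_sub_le_sqrt (W : ι → ℝ) (m : ℝ) :
    𝔼 ω ∈ Ω, |W ω - m| ≤ √(𝔼 ω ∈ Ω, (W ω - m) ^ 2) := by
  refine Real.le_sqrt_of_sq_le ?_
  rcases Ω.eq_empty_or_nonempty with rfl | hΩ
  · simp
  have hc : (0 : ℝ) < Ω.card := by exact_mod_cast card_pos.2 hΩ
  rw [expect_eq_sum_div_card, expect_eq_sum_div_card, div_pow, div_le_div_iff₀ (by positivity) hc]
  have h := sq_sum_le_card_mul_sum_sq (s := Ω) (f := fun ω => |W ω - m|)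
  simp only [sq_abs] at h
  nlinarith

/-- The variance of `Z` in terms of a size-bias coupling. -/
lemma expect_sq_sub_eq_of_size_bias (hΩ : Ω.Nonempty) (hJ : J.Nonempty) {Z : ι → ℝ}
    {Z' : κ → ι → ℝ} {μ b : ℝ} {ρ : ι → ℝ}
    (hsize : ∀ F : ℝ → ℝ, 𝔼 ω ∈ Ω, Z ω * F (Z ω) = μ * 𝔼 ω ∈ Ω, 𝔼 i ∈ J, F (Z' i ω))
    (hlin : ∀ g : ℝ → ℝ, 𝔼 ω ∈ Ω, g (Z ω) * 𝔼 i ∈ J, (Z' i ω - Z ω) =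
      𝔼 ω ∈ Ω, g (Z ω) * (1 - b * Z ω + ρ ω)) :
    𝔼 ω ∈ Ω, (Z ω - μ) ^ 2 = μ * (1 - b * μ + 𝔼 ω ∈ Ω, ρ ω) := by
  have hmean : 𝔼 ω ∈ Ω, Z ω = μ := by
    have := hsize fun _ => 1
    simp only [mul_one, expect_const hJ, expect_const hΩ] at this
    exact this
  -- With `g = 1` this gives E Z' - μ = 1 - bμ + Eρ, and `hsize` with the identity gives E Z² = μ E
  -- Z'.
  have h1 := hlin fun _ => 1
  simp only [one_mul, expect_add_distrib, expect_sub_distrib, expect_const hJ, expect_const hΩ,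
    ← mul_expect, hmean] at h1
  have h2 := hsize fun z => z
  have h3 : 𝔼 ω ∈ Ω, (Z ω - μ) ^ 2 = 𝔼 ω ∈ Ω, Z ω * Z ω - μ * μ := by
    have : ∀ ω ∈ Ω, (Z ω - μ) ^ 2 = Z ω * Z ω - 2 * μ * Z ω + μ ^ 2 := fun ω _ => by ring
    rw [expect_congr rfl this, expect_add_distrib, expect_sub_distrib, ← mul_expect, hmean,
      expect_const hΩ]
    ring
  rw [h3, h2, ← h1]
  ring

/-- Stein's method for a size-bias coupling `Z'` of `Z`: if the mean increment is, as far as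
functions of `Z` are concerned, an affine function of `Z` up to the error `ρ`, then the standardised
`Z` is nearly Gaussian. -/
theorem abs_expect_sub_integral_gaussianReal_le (hΩ : Ω.Nonempty) (hJ : J.Nonempty) {Z : ι → ℝ}
    {Z' : κ → ι → ℝ} {μ σ b : ℝ} {ρ : ι → ℝ} (hσ : 0 < σ) (hμ : 0 < μ) (hb : 0 ≤ b)
    (hρ : ∀ ω, 0 ≤ ρ ω)
    (hvar : 𝔼 ω ∈ Ω, (Z ω - μ) ^ 2 = σ ^ 2)
    (hsize : ∀ F : ℝ → ℝ, 𝔼 ω ∈ Ω, Z ω * F (Z ω) = μ * 𝔼 ω ∈ Ω, 𝔼 i ∈ J, F (Z' i ω))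
    (hlin : ∀ g : ℝ → ℝ, 𝔼 ω ∈ Ω, g (Z ω) * 𝔼 i ∈ J, (Z' i ω - Z ω) =
      𝔼 ω ∈ Ω, g (Z ω) * (1 - b * Z ω + ρ ω))
    {h h' : ℝ → ℝ} (hh : ∀ y, HasDerivAt h (h' y) y) (hh' : ∀ y, |h' y| ≤ 1) :
    |𝔼 ω ∈ Ω, h ((Z ω - μ) / σ) - ∫ y, h y ∂(gaussianReal 0 1)| ≤
      8 * (μ / σ ^ 2) * (2 * 𝔼 ω ∈ Ω, ρ ω + b * σ) +
        12 * (μ / σ ^ 3) * 𝔼 ω ∈ Ω, 𝔼 i ∈ J, (Z' i ω - Z ω) ^ 2 := by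
  obtain ⟨f, f₁, f₂, hf, hf₁, hstein, hb₁, hb₂⟩ := exists_stein_solution hh hh'
  have hσμ := hvar.symm.trans (expect_sq_sub_eq_of_size_bias hΩ hJ hsize hlin)
  set r := 𝔼 ω ∈ Ω, ρ ω with hr
  set W : ι → ℝ := fun ω => (Z ω - μ) / σ with hW
  set W' : κ → ι → ℝ := fun i ω => (Z' i ω - μ) / σ with hW'
  have h1 : 𝔼 ω ∈ Ω, W ω * f (W ω) = μ / σ * 𝔼 ω ∈ Ω, 𝔼 i ∈ J, (f (W' i ω) - f (W ω)) := by
    have h2 := hsize fun z => f ((z - μ) / σ)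
    have h3 : ∀ ω ∈ Ω, W ω * f (W ω) = (Z ω * f ((Z ω - μ) / σ) - μ * f (W ω)) / σ := fun ω _ => by
      simp only [hW]
      ring
    rw [expect_congr rfl h3, ← expect_div, expect_sub_distrib, h2, ← mul_expect]
    simp only [expect_sub_distrib, expect_const hJ]
    ring
  have h2 : 𝔼 ω ∈ Ω, h (W ω) - ∫ y, h y ∂(gaussianReal 0 1) =
      𝔼 ω ∈ Ω, (f₁ (W ω) - W ω * f (W ω)) := by
    simp only [hstein, expect_sub_distrib, expect_const hΩ]
  -- Expand f(W') about W: the linear term is evaluated by `hlin`, the remainder is quadratic in Z'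
  -- - Z.
  have h3 : 𝔼 ω ∈ Ω, (f₁ (W ω) - W ω * f (W ω)) =
      𝔼 ω ∈ Ω, f₁ (W ω) * (1 - μ / σ ^ 2 * (1 - b * Z ω + ρ ω)) -
      μ / σ * 𝔼 ω ∈ Ω, 𝔼 i ∈ J, (f (W' i ω) - f (W ω) - f₁ (W ω) * (W' i ω - W ω)) := by
    have h4 := hlin fun z => f₁ ((z - μ) / σ)
    have h5 : 𝔼 ω ∈ Ω, 𝔼 i ∈ J, f₁ (W ω) * (W' i ω - W ω) =
        (𝔼 ω ∈ Ω, f₁ (W ω) * (1 - b * Z ω + ρ ω)) / σ := by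
      rw [← h4, expect_div]
      refine expect_congr rfl fun ω _ => ?_
      rw [← mul_expect, mul_div_assoc, expect_div]
      congr 1
      refine expect_congr rfl fun i _ => ?_
      simp only [hW, hW']
      ring
    have h6 : ∀ ω ∈ Ω, f₁ (W ω) * (1 - μ / σ ^ 2 * (1 - b * Z ω + ρ ω)) =
        f₁ (W ω) - μ / σ ^ 2 * (f₁ (W ω) * (1 - b * Z ω + ρ ω)) := fun ω _ => by ring
    rw [expect_sub_distrib, h1, expect_congr rfl h6, expect_sub_distrib, ← mul_expect]
    have h7 : 𝔼 ω ∈ Ω, 𝔼 i ∈ J, (f (W' i ω) - f (W ω) - f₁ (W ω) * (W' i ω - W ω)) =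
        𝔼 ω ∈ Ω, 𝔼 i ∈ J, (f (W' i ω) - f (W ω)) -
        𝔼 ω ∈ Ω, 𝔼 i ∈ J, f₁ (W ω) * (W' i ω - W ω) := by
      rw [← expect_sub_distrib]
      exact expect_congr rfl fun ω _ => expect_sub_distrib _ _ _
    rw [h7, h5]
    field_simp
    ring
  have hA : |𝔼 ω ∈ Ω, f₁ (W ω) * (1 - μ / σ ^ 2 * (1 - b * Z ω + ρ ω))| ≤
      8 * (μ / σ ^ 2) * (2 * r + b * σ) := by
    -- The variance formula makes the constants cancel exactly, leaving only the centred
    -- fluctuations of ρ and bZ.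
    have h4 : ∀ ω, 1 - μ / σ ^ 2 * (1 - b * Z ω + ρ ω) =
        μ / σ ^ 2 * (r - ρ ω + b * (Z ω - μ)) := fun ω => by
      have : μ * (1 - b * μ + r) / σ ^ 2 = 1 := by rw [← hσμ]; field_simp
      linear_combination -this
    have hμσ : 0 ≤ μ / σ ^ 2 := by positivity
    have hr0 : 0 ≤ r := expect_nonneg fun ω _ => hρ ω
    calc _ ≤ 𝔼 ω ∈ Ω, |f₁ (W ω) * (1 - μ / σ ^ 2 * (1 - b * Z ω + ρ ω))| := abs_expect_le _ _
      _ ≤ 𝔼 ω ∈ Ω, 8 * (μ / σ ^ 2) * (r + ρ ω + b * |Z ω - μ|) := by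
        refine expect_le_expect fun ω _ => ?_
        rw [abs_mul, h4, abs_mul, abs_of_nonneg hμσ, mul_assoc]
        refine mul_le_mul (hb₁ _) ?_ (by positivity) (by norm_num)
        refine mul_le_mul_of_nonneg_left ?_ hμσ
        refine (abs_add_le _ _).trans (add_le_add ?_ ?_)
        · rw [abs_le]
          constructor <;> linarith [hρ ω]
        · rw [abs_mul, abs_of_nonneg hb]
      _ = 8 * (μ / σ ^ 2) * (r + r + b * 𝔼 ω ∈ Ω, |Z ω - μ|) := by
        rw [← mul_expect, expect_add_distrib, expect_add_distrib, expect_const hΩ, ← mul_expect]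
      _ ≤ 8 * (μ / σ ^ 2) * (2 * r + b * σ) := by
        have h5 := expect_abs_sub_le_sqrt (Ω := Ω) Z μ
        rw [hvar, Real.sqrt_sq hσ.le] at h5
        have := mul_le_mul_of_nonneg_left h5 hb
        refine mul_le_mul_of_nonneg_left ?_ (by positivity)
        linarith
  have hB : |μ / σ * 𝔼 ω ∈ Ω, 𝔼 i ∈ J, (f (W' i ω) - f (W ω) - f₁ (W ω) * (W' i ω - W ω))| ≤
      12 * (μ / σ ^ 3) * 𝔼 ω ∈ Ω, 𝔼 i ∈ J, (Z' i ω - Z ω) ^ 2 := by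
    have hμσ : 0 ≤ μ / σ := by positivity
    rw [abs_mul, abs_of_nonneg hμσ]
    have h4 : |𝔼 ω ∈ Ω, 𝔼 i ∈ J, (f (W' i ω) - f (W ω) - f₁ (W ω) * (W' i ω - W ω))| ≤
        𝔼 ω ∈ Ω, 𝔼 i ∈ J, 12 / σ ^ 2 * (Z' i ω - Z ω) ^ 2 := by
      refine (abs_expect_le _ _).trans (expect_le_expect fun ω _ => ?_)
      refine (abs_expect_le _ _).trans (expect_le_expect fun i _ => ?_)
      refine (abs_sub_sub_mul_le_of_deriv_bound hf hf₁ hb₂ _ _).trans_eq ?_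
      simp only [hW, hW']
      field_simp
      ring
    refine (mul_le_mul_of_nonneg_left h4 hμσ).trans_eq ?_
    simp only [← mul_expect]
    field_simp
  rw [h2, h3]
  exact (abs_sub _ _).trans (add_le_add hA hB)

end SizeBias

/-! ### The Wasserstein bound in terms of the mean. -/

section Approximation

open Finset
open scoped BigOperators

variable {n s k : ℕ}

lemma drawingsLaw_eq (n s k : ℕ) :
    drawingsLaw n s k = uniformOn (seqs k (draws n s) : Set (Fin k → Finset (Fin n))) := by
  have h : (seqs k (draws n s) : Set (Fin k → Finset (Fin n))) =
      Set.univ.pi fun _ => {A : Finset (Fin n) | A.card = s} := by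
    ext ω
    simp [seqs, draws, Set.mem_pi]
  rw [h, uniformOn_pi]
  rfl

lemma seqs_draws_nonempty (h : s ≤ n) : (seqs k (draws n s)).Nonempty := by
  rw [← card_pos, card_seqs]
  exact pow_pos (card_pos.2 (draws_nonempty h)) k

lemma isProbabilityMeasure_drawingsLaw (h : s ≤ n) :
    IsProbabilityMeasure (drawingsLaw n s k) := by
  rw [drawingsLaw_eq]
  exact isProbabilityMeasure_uniformOn (finite_toSet _) (seqs_draws_nonempty h)

lemma integral_drawingsLaw (h : s ≤ n) (g : (Fin k → Finset (Fin n)) → ℝ) :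
    ∫ ω, g ω ∂(drawingsLaw n s k) = 𝔼 ω ∈ seqs k (draws n s), g ω := by
  have := isProbabilityMeasure_drawingsLaw (k := k) h
  have hc : ((seqs k (draws n s)).card : ℝ) ≠ 0 := by
    exact_mod_cast (card_pos.2 (seqs_draws_nonempty h)).ne'
  rw [integral_fintype .of_finite, expect_eq_sum_div_card, sum_div,
    ← sum_subset (subset_univ (seqs k (draws n s)))]
  · refine sum_congr rfl fun ω hω => ?_
    rw [measureReal_def, drawingsLaw_eq, ← coe_singleton, uniformOn_apply_finset,
      inter_singleton_of_mem hω]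
    simp only [card_singleton, Nat.cast_one, ENNReal.toReal_div, ENNReal.toReal_one,
      ENNReal.toReal_natCast, smul_eq_mul]
    ring
  · intro ω _ hω
    rw [measureReal_def, drawingsLaw_eq, ← coe_singleton, uniformOn_apply_finset,
      inter_singleton_of_notMem hω]
    simp

lemma variance_drawingsLaw (h : s < n) :
    variance (Z n k) (drawingsLaw n s k) =
      𝔼 ω ∈ seqs k (draws n s), (Z n k ω - n * (((n : ℝ) - s) / n) ^ k) ^ 2 := by
  rw [variance_eq_integral (measurable_of_finite _).aemeasurable, integral_drawingsLaw h.le,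
    integral_drawingsLaw h.le, expect_Z h]

/-- The arithmetic that turns the error terms of Stein's method into a multiple of `1 / √μ`. -/
lemma stein_error_le {n μ σ b r Q : ℝ} (hn : 1 ≤ n) (hμ : 0 < μ) (hμn : μ ≤ n) (hσ : 0 ≤ σ)
    (hb : 0 ≤ b) (hbμ : b * μ ≤ 1 / 16) (hr : 0 ≤ r) (hrn : r ≤ 1 / n) (hQ : Q ≤ 2)
    (hσ2 : σ ^ 2 = μ * (1 - b * μ + r)) :
    0 < σ ∧ 8 * (μ / σ ^ 2) * (2 * r + b * σ) + 12 * (μ / σ ^ 3) * Q ≤ 200 / √μ := by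
  have hn0 : 0 < n := by linarith
  have hr1 : r ≤ 1 := hrn.trans (div_le_one_of_le₀ hn hn0.le)
  have hbμ0 : 0 ≤ b * μ := by positivity
  have hσl : μ / 2 ≤ σ ^ 2 := by
    rw [hσ2, div_eq_mul_one_div]
    exact mul_le_mul_of_nonneg_left (by linarith) hμ.le
  have hσu : σ ^ 2 ≤ 2 * μ := by
    rw [hσ2, mul_comm 2 μ]
    exact mul_le_mul_of_nonneg_left (by linarith) hμ.le
  have hσ0 : 0 < σ := by
    refine hσ.lt_of_ne fun h0 => ?_
    rw [← h0] at hσl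
    linarith
  refine ⟨hσ0, ?_⟩
  have hμσ : μ / σ ^ 2 ≤ 2 := by
    rw [div_le_iff₀ (by positivity)]
    linarith
  have hσn : σ ≤ 2 * n := by
    have h4 : σ ^ 2 ≤ (2 * n) ^ 2 := by nlinarith
    exact (pow_le_pow_iff_left₀ hσ0.le (by positivity) two_ne_zero).1 h4
  have hrσ : r * σ ≤ 2 := by
    calc r * σ ≤ 1 / n * (2 * n) := mul_le_mul hrn hσn hσ0.le (by positivity)
      _ = 2 := by field_simp
  have hbσ : b * σ * σ ≤ 1 / 8 := by
    have := mul_le_mul_of_nonneg_left hσu hb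
    nlinarith
  -- After multiplication by σ the bracket is at most 8(4 + 1/8) + 24 = 57 ≤ 60, and μ/σ² ≤ 2.
  -- Passing from σ to √μ then costs a factor 3/2.
  have h4 : 8 * (μ / σ ^ 2) * (2 * r + b * σ) + 12 * (μ / σ ^ 3) * Q ≤ 120 / σ := by
    rw [le_div_iff₀ hσ0]
    have h5 : (8 * (μ / σ ^ 2) * (2 * r + b * σ) + 12 * (μ / σ ^ 3) * Q) * σ =
        μ / σ ^ 2 * (8 * (2 * (r * σ) + b * σ * σ) + 12 * Q) := by
      field_simp
    rw [h5]
    have h6 : 8 * (2 * (r * σ) + b * σ * σ) + 12 * Q ≤ 60 := by linarith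
    have h7 : 0 ≤ μ / σ ^ 2 := by positivity
    nlinarith
  refine h4.trans ?_
  rw [div_le_div_iff₀ hσ0 (Real.sqrt_pos.2 hμ)]
  have h5 : √μ ≤ 3 / 2 * σ := by
    rw [Real.sqrt_le_iff]
    exact ⟨by positivity, by nlinarith⟩
  linarith

/-- A bound for differentiable Lipschitz test functions. -/
lemma abs_expect_standardized_sub_le_of_hasDerivAt (h : s < n) (h2 : 2 * s ≤ n)
    (hε : (1 + s * k / n : ℝ) ^ 2 * (((n : ℝ) - s) / n) ^ k ≤ 1 / 16)
    {f f' : ℝ → ℝ} (hf : ∀ y, HasDerivAt f (f' y) y) (hf' : ∀ y, |f' y| ≤ 1) :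
    |∫ ω, f (standardizedZ n s k ω) ∂(drawingsLaw n s k) - ∫ y, f y ∂(gaussianReal 0 1)| ≤
      200 / √(n * (((n : ℝ) - s) / n) ^ k) := by
  have hn : (0 : ℝ) < n := by exact_mod_cast (Nat.zero_le _).trans_lt h
  have hn1 : (1 : ℝ) ≤ n := by exact_mod_cast (Nat.zero_le _).trans_lt h
  have hns : (0 : ℝ) < (n : ℝ) - s := sub_pos.2 (by exact_mod_cast h)
  have hns2 : (n : ℝ) / 2 ≤ (n : ℝ) - s := by
    have : (2 : ℝ) * s ≤ n := by exact_mod_cast h2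
    linarith
  have hT : (seqs k (markedDraws n s)).Nonempty := by
    rw [← card_pos, card_seqs]
    exact pow_pos (card_pos.2 (markedDraws_nonempty h)) k
  have hJ : (univ : Finset (Fin n)).Nonempty := ⟨⟨0, by omega⟩, mem_univ _⟩
  set p : ℝ := (((n : ℝ) - s) / n) ^ k with hp
  have hp0 : 0 < p := by positivity
  set μ : ℝ := n * p with hμ
  have hμ0 : 0 < μ := by positivity
  set u : ℝ := s * k / n with hu
  have hu0 : 0 ≤ u := by positivity
  have hsk : (s * k : ℝ) = u * n := by rw [hu]; field_simp
  have hp1 : p ≤ 1 := by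
    refine pow_le_one₀ (by positivity) (div_le_one_of_le₀ ?_ hn.le)
    have := Nat.cast_nonneg (α := ℝ) s
    linarith
  have hμn : μ ≤ n := by nlinarith
  have hsize : ∀ F : ℝ → ℝ,
      𝔼 τ ∈ seqs k (markedDraws n s), Z n k (drawnSets τ) * F (Z n k (drawnSets τ)) =
        μ * 𝔼 τ ∈ seqs k (markedDraws n s), 𝔼 i : Fin n, F (replacedZ i τ) :=
    expect_Z_mul_comp_Z h
  have hlin := expect_mul_expect_replacedZ_sub (k := k) h
  set b : ℝ := 1 / n + s * k / (n * ((n : ℝ) - s)) with hb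
  have hb0 : 0 ≤ b := by positivity
  have hbn : b * n ≤ 1 + 2 * u := by
    have h3 : b * n = 1 + u * (n / ((n : ℝ) - s)) := by
      rw [hb, hsk]
      field_simp
    have h4 : (n : ℝ) / ((n : ℝ) - s) ≤ 2 := by
      rw [div_le_iff₀ hns]
      linarith
    rw [h3]
    nlinarith
  set r : ℝ := 𝔼 τ ∈ seqs k (markedDraws n s), collisionExcess τ with hr
  have hr0 : 0 ≤ r := expect_nonneg fun τ _ => collisionExcess_nonneg τ
  set Q : ℝ := 𝔼 τ ∈ seqs k (markedDraws n s), 𝔼 i : Fin n,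
    (replacedZ i τ - Z n k (drawnSets τ)) ^ 2 with hQ
  -- Here `u` is the mean number of times that a given coupon is drawn. The threshold 1/16 offsets
  -- the factor 2⁴ that bounds (n/(n-s))⁴ in the estimate of `r`.
  have hε' : u * p ≤ 1 / 16 ∧ u ^ 2 * p ≤ 1 / 16 ∧ (1 + 2 * u) * p ≤ 1 / 16 := by
    have h3 : 0 ≤ u * p := by positivity
    have h4 : 0 ≤ u ^ 2 * p := by positivity
    refine ⟨?_, ?_, ?_⟩ <;> nlinarith
  have hbμ : b * μ ≤ 1 / 16 := by
    rw [hμ, ← mul_assoc]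
    exact (mul_le_mul_of_nonneg_right hbn hp0.le).trans hε'.2.2
  have hrn : r ≤ 1 / n := by
    refine (expect_collisionExcess_le h).trans ?_
    have h3 : (k : ℝ) ^ 2 * (n ^ 2 * p * (s / ((n : ℝ) - s)) ^ 2 / ((n : ℝ) - s) ^ 2) / n =
        (u ^ 2 * p) * (n / ((n : ℝ) - s)) ^ 4 / n := by
      rw [hu]
      field_simp
    rw [h3]
    refine div_le_div_of_nonneg_right ?_ hn.le
    have h4 : (n : ℝ) / ((n : ℝ) - s) ≤ 2 := by
      rw [div_le_iff₀ hns]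
      linarith
    have h5 : ((n : ℝ) / ((n : ℝ) - s)) ^ 4 ≤ 2 ^ 4 := pow_le_pow_left₀ (by positivity) h4 4
    have h6 : 0 ≤ u ^ 2 * p := by positivity
    nlinarith [hε'.2.1]
  have hQ2 : Q ≤ 2 := by
    refine (expect_sq_replacedZ_sub_le h).trans ?_
    have h3 : (k * (s * μ / ((n : ℝ) - s)) +
        k ^ 2 * (n ^ 2 * p * (s / ((n : ℝ) - s)) ^ 2 / ((n : ℝ) - s))) / n =
        (u * p) * (n / ((n : ℝ) - s)) + (u ^ 2 * p) * (n / ((n : ℝ) - s)) ^ 3 := by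
      rw [hu, hμ]
      field_simp
    rw [h3]
    have h4 : (n : ℝ) / ((n : ℝ) - s) ≤ 2 := by
      rw [div_le_iff₀ hns]
      linarith
    have h5 : ((n : ℝ) / ((n : ℝ) - s)) ^ 3 ≤ 2 ^ 3 := pow_le_pow_left₀ (by positivity) h4 3
    have h6 : 0 ≤ u ^ 2 * p := by positivity
    have h7 : 0 ≤ u * p := by positivity
    nlinarith [hε'.1, hε'.2.1]
  clear_value μ b
  have hvar : 𝔼 τ ∈ seqs k (markedDraws n s), (Z n k (drawnSets τ) - μ) ^ 2 =
      μ * (1 - b * μ + r) :=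
    expect_sq_sub_eq_of_size_bias hT hJ hsize hlin
  have hvar' : variance (Z n k) (drawingsLaw n s k) = μ * (1 - b * μ + r) := by
    rw [variance_drawingsLaw h, ← expect_drawnSets h fun ω => (Z n k ω - _) ^ 2, ← hμ]
    exact hvar
  have hσ2 : √(variance (Z n k) (drawingsLaw n s k)) ^ 2 = μ * (1 - b * μ + r) := by
    rw [Real.sq_sqrt (variance_nonneg _ _), hvar']
  obtain ⟨hσ0, herr⟩ := stein_error_le hn1 hμ0 hμn (Real.sqrt_nonneg _) hb0 hbμ hr0 hrn hQ2 hσ2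
  have h3 : ∫ ω, f (standardizedZ n s k ω) ∂(drawingsLaw n s k) =
      𝔼 τ ∈ seqs k (markedDraws n s),
        f ((Z n k (drawnSets τ) - μ) / √(variance (Z n k) (drawingsLaw n s k))) := by
    rw [integral_drawingsLaw h.le,
      expect_drawnSets h fun ω => f ((Z n k ω - μ) / √(variance (Z n k) (drawingsLaw n s k)))]
    refine expect_congr rfl fun ω _ => ?_
    rw [standardizedZ, integral_drawingsLaw h.le, expect_Z h, hμ]
  rw [h3]
  exact (abs_expect_sub_integral_gaussianReal_le hT hJ hσ0 hμ0 hb0 collisionExcess_nonneg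
    (hvar.trans hσ2.symm) hsize hlin hf hf').trans herr

/-- A bound on the Wasserstein distance of the standardised number of coupons not drawn to the
standard Gaussian law. -/
theorem wassersteinDist_standardizedZ_le (h : s < n) (h2 : 2 * s ≤ n)
    (hε : (1 + s * k / n : ℝ) ^ 2 * (((n : ℝ) - s) / n) ^ k ≤ 1 / 16) :
    wassersteinDist ((drawingsLaw n s k).map (standardizedZ n s k)) (gaussianReal 0 1) ≤
      ENNReal.ofReal (200 / √(n * (((n : ℝ) - s) / n) ^ k)) := by
  have := isProbabilityMeasure_drawingsLaw (k := k) h.le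
  refine iSup₂_le fun f hf => ENNReal.ofReal_le_ofReal ?_
  rw [integral_map (measurable_of_finite _).aemeasurable hf.continuous.aestronglyMeasurable]
  refine le_of_forall_pos_le_add fun ε hε' => ?_
  -- Smoothing costs ε/2 under each of the two laws, and the bound for smooth test functions does
  -- not depend on ε.
  obtain ⟨g, g', hg, hg', hgf⟩ := exists_hasDerivAt_near_lipschitzWith hf (half_pos hε')
  have hgc : Continuous g := continuous_iff_continuousAt.2 fun y => (hg y).continuousAt
  have h1 := abs_expect_standardized_sub_le_of_hasDerivAt h h2 hε hg hg'
  have h3 : |∫ ω, f (standardizedZ n s k ω) ∂(drawingsLaw n s k) -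
      ∫ ω, g (standardizedZ n s k ω) ∂(drawingsLaw n s k)| ≤ ε / 2 := by
    rw [← integral_sub .of_finite .of_finite]
    refine (norm_integral_le_of_norm_le_const (μ := drawingsLaw n s k)
      (f := fun ω => f (standardizedZ n s k ω) - g (standardizedZ n s k ω)) (C := ε / 2)
      (ae_of_all _ fun ω => ?_)).trans_eq ?_
    · rw [Real.norm_eq_abs, abs_sub_comm]
      exact hgf _
    · simp
  have h4 : |∫ y, g y ∂(gaussianReal 0 1) - ∫ y, f y ∂(gaussianReal 0 1)| ≤ ε / 2 := by
    have hfi := integrable_gaussianReal_of_lipschitzWith hf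
    have hgi : Integrable g (gaussianReal 0 1) := by
      refine (hfi.norm.add (integrable_const (ε / 2))).mono' hgc.aestronglyMeasurable
        (ae_of_all _ fun y => ?_)
      have := hgf y
      have h5 := abs_sub_abs_le_abs_sub (g y) (f y)
      simp only [Real.norm_eq_abs, Pi.add_apply]
      linarith
    rw [← integral_sub hgi hfi]
    refine (norm_integral_le_of_norm_le_const (μ := gaussianReal 0 1)
      (f := fun y => g y - f y) (C := ε / 2)
      (ae_of_all _ hgf)).trans_eq ?_
    simp
  rw [abs_le] at h1 h3 h4 ⊢
  constructor <;> linarith [h1.1, h1.2, h3.1, h3.2, h4.1, h4.2]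

end Approximation

/-! ### Asymptotics of the mean for the given numbers of drawings. -/

section Asymptotics

open Finset Filter Topology
open scoped BigOperators

/-- The drawing numbers of the theorem lead into the range of `wassersteinDist_standardizedZ_le`,
with a mean of order `n ^ (1 - α)`. -/
lemma eventually_bounds_of_abs_sub_lt_one {s : ℕ} (hs : 1 ≤ s) (x : ℝ) {α : ℝ} (hα : 0 < α)
    (hα1 : α < 1) :
    ∀ᶠ n : ℕ in atTop, s < n ∧ 2 * s ≤ n ∧ 1 ≤ Real.log n ∧ ∀ k : ℕ,
      |(k : ℝ) - (n : ℝ) / (s : ℝ) * (α * Real.log n + x)| < 1 →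
        (1 + s * k / n : ℝ) ^ 2 * (((n : ℝ) - s) / n) ^ k ≤ 1 / 16 ∧
          Real.exp (-x - 1) * (n : ℝ) ^ (1 - α) ≤ n * (((n : ℝ) - s) / n) ^ k := by
  have hlog : Tendsto (fun n : ℕ => Real.log n) atTop atTop :=
    Real.tendsto_log_atTop.comp tendsto_natCast_atTop_atTop
  have hlim1 : Tendsto (fun n : ℕ => (Real.log n + |x| + 2) ^ 2 *
      (Real.exp (1 - x) * Real.exp (-(α * Real.log n)))) atTop (𝓝 0) := by
    have h0 : Tendsto (fun t : ℝ => (t + |x| + 2) ^ 2 *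
        (Real.exp (1 - x) * Real.exp (-(α * t)))) atTop (𝓝 0) := by
      have hpow : ∀ m : ℕ, Tendsto (fun t : ℝ => t ^ m * Real.exp (-(α * t))) atTop (𝓝 0) := by
        intro m
        have h1 := ((Real.tendsto_pow_mul_exp_neg_atTop_nhds_zero m).comp
          (tendsto_id.const_mul_atTop hα)).const_mul ((α ^ m)⁻¹)
        rw [mul_zero] at h1
        refine h1.congr fun t => ?_
        simp only [Function.comp, id, mul_pow]
        field_simp
      have h1 := (((hpow 2).add ((hpow 1).const_mul (2 * (|x| + 2)))).add
        ((hpow 0).const_mul ((|x| + 2) ^ 2))).const_mul (Real.exp (1 - x))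
      simp only [mul_zero, add_zero] at h1
      refine h1.congr fun t => ?_
      ring
    exact h0.comp hlog
  have hlim2 : Tendsto (fun n : ℕ => 2 * (s : ℝ) * ((Real.log n + |x| + 1) / n)) atTop (𝓝 0) := by
    have h1 : Tendsto (fun t : ℝ => Real.log t / t) atTop (𝓝 0) :=
      Real.isLittleO_log_id_atTop.tendsto_div_nhds_zero
    have h2 : Tendsto (fun t : ℝ => (|x| + 1) / t) atTop (𝓝 0) :=
      tendsto_const_nhds.div_atTop tendsto_id
    have h3 := ((h1.add h2).comp (tendsto_natCast_atTop_atTop (R := ℝ))).const_mul (2 * (s : ℝ))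
    simp only [add_zero, mul_zero] at h3
    refine h3.congr fun n => ?_
    simp only [Function.comp]
    ring
  filter_upwards [eventually_ge_atTop (2 * s), hlog.eventually_ge_atTop 1,
    hlim1.eventually_le_const (by norm_num : (0 : ℝ) < 1 / 16),
    hlim2.eventually_le_const (by norm_num : (0 : ℝ) < 1 / 2)] with n hn hlogn h1 h2
  have hsn : s < n := by omega
  refine ⟨hsn, hn, hlogn, fun k hk => ?_⟩
  have hs0 : (0 : ℝ) < s := by exact_mod_cast hs
  have hn0 : (0 : ℝ) < n := by exact_mod_cast (Nat.zero_le _).trans_lt hsn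
  have hns : (0 : ℝ) < (n : ℝ) - s := sub_pos.2 (by exact_mod_cast hsn)
  have hns2 : 2 * (s : ℝ) ≤ n := by exact_mod_cast hn
  set u : ℝ := s * k / n with hu
  have hu0 : 0 ≤ u := by positivity
  -- Rounding `k` moves `u` by less than s/n ≤ 1/2.
  have hu1 : |u - (α * Real.log n + x)| ≤ 1 / 2 := by
    have h3 : u - (α * Real.log n + x) =
        s / n * ((k : ℝ) - (n : ℝ) / (s : ℝ) * (α * Real.log n + x)) := by
      rw [hu]
      field_simp
    rw [h3, abs_mul, abs_of_pos (by positivity)]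
    have h4 : (s : ℝ) / n ≤ 1 / 2 := by
      rw [div_le_iff₀ hn0]
      linarith
    calc _ ≤ (1 / 2 : ℝ) * 1 := mul_le_mul h4 hk.le (abs_nonneg _) (by norm_num)
      _ = 1 / 2 := by norm_num
  rw [abs_le] at hu1
  have hu2 : u ≤ Real.log n + |x| + 1 := by
    have := le_abs_self x
    nlinarith
  have hq : ((n : ℝ) - s) / n = 1 - s / n := by field_simp
  have hq0 : 0 < ((n : ℝ) - s) / n := by positivity
  constructor
  · refine le_trans (mul_le_mul ?_ ?_ (by positivity) (by positivity)) h1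
    · exact pow_le_pow_left₀ (by positivity) (by linarith) 2
    · calc (((n : ℝ) - s) / n) ^ k ≤ Real.exp (-(s / n)) ^ k := by
            refine pow_le_pow_left₀ hq0.le ?_ k
            rw [hq]
            exact Real.one_sub_le_exp_neg _
        _ = Real.exp (-u) := by
            rw [← Real.exp_nat_mul, hu]
            congr 1
            ring
        _ ≤ Real.exp (1 - x) * Real.exp (-(α * Real.log n)) := by
            rw [← Real.exp_add]
            exact Real.exp_le_exp.2 (by linarith)
  · have h3 : Real.exp (-(s / ((n : ℝ) - s))) ≤ ((n : ℝ) - s) / n := by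
      rw [Real.exp_neg, inv_le_comm₀ (Real.exp_pos _) hq0, inv_div]
      have := Real.add_one_le_exp (s / ((n : ℝ) - s))
      refine le_trans (le_of_eq ?_) this
      field_simp
      ring
    -- The price of replacing s/n by s/(n-s) in the exponent is of order (log n)/n. This 1/2 and the
    -- 1/2 from rounding make up the 1 in exp(-x-1).
    have h4 : k * (s / ((n : ℝ) - s)) ≤ u + 1 / 2 := by
      have h5 : k * (s / ((n : ℝ) - s)) = u + u * (s / ((n : ℝ) - s)) := by
        rw [hu]
        field_simp
        ring
      have h6 : (s : ℝ) / ((n : ℝ) - s) ≤ 2 * s / n := by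
        rw [div_le_div_iff₀ hns hn0]
        nlinarith
      rw [h5]
      have h7 : u * (s / ((n : ℝ) - s)) ≤ (Real.log n + |x| + 1) * (2 * s / n) :=
        mul_le_mul hu2 h6 (by positivity) (hu0.trans hu2)
      have h8 : (Real.log n + |x| + 1) * (2 * s / n) =
          2 * (s : ℝ) * ((Real.log n + |x| + 1) / n) := by ring
      linarith
    calc Real.exp (-x - 1) * (n : ℝ) ^ (1 - α)
        = n * Real.exp (-x - 1 - α * Real.log n) := by
          rw [sub_eq_add_neg 1 α, Real.rpow_add hn0, Real.rpow_one, Real.rpow_def_of_pos hn0,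
            sub_eq_add_neg (-x - 1), Real.exp_add]
          ring_nf
      _ ≤ n * Real.exp (-(s / ((n : ℝ) - s))) ^ k := by
          rw [← Real.exp_nat_mul]
          refine mul_le_mul_of_nonneg_left (Real.exp_le_exp.2 ?_) hn0.le
          linarith
      _ ≤ _ := by gcongr

end Asymptotics

end CouponCollector

theorem theorem2p1 (s : ℕ) (hs : 1 ≤ s) (x : ℝ) :
    ∃ C : ℝ, 0 < C ∧
      ∀ α : ℝ, 0 < α → α < 1 →
        ∃ N : ℕ, ∀ n : ℕ, N ≤ n →
          ∀ k : ℕ, |(k : ℝ) - (n : ℝ) / (s : ℝ) * (α * Real.log n + x)| < 1 →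
            (α ≤ 1 / 3 →
              CouponCollector.wassersteinDist
                  ((CouponCollector.drawingsLaw n s k).map (CouponCollector.standardizedZ n s k))
                  (gaussianReal 0 1)
                ≤ ENNReal.ofReal (C * (√(Real.log n) / (n : ℝ) ^ α))) ∧
            (1 / 3 < α →
              CouponCollector.wassersteinDist
                  ((CouponCollector.drawingsLaw n s k).map (CouponCollector.standardizedZ n s k))
                  (gaussianReal 0 1)
                ≤ ENNReal.ofReal (C * (n : ℝ) ^ (-((1 - α) / 2)))) := by
  -- The exponential is the inverse square root of the factor exp(-x-1) in the lower bound for the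
  -- mean.
  refine ⟨200 * Real.exp ((x + 1) / 2), by positivity, fun α hα hα1 => ?_⟩
  obtain ⟨N, hN⟩ := Filter.eventually_atTop.1
    (CouponCollector.eventually_bounds_of_abs_sub_lt_one hs x hα hα1)
  refine ⟨N, fun n hn k hk => ?_⟩
  obtain ⟨hsn, h2s, hlog, hbd⟩ := hN n hn
  obtain ⟨hε, hmean⟩ := hbd k hk
  have hn0 : (0 : ℝ) < n := by exact_mod_cast (Nat.zero_le _).trans_lt hsn
  have hn1 : (1 : ℝ) ≤ n := by exact_mod_cast (Nat.zero_le _).trans_lt hsn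
  have hd := CouponCollector.wassersteinDist_standardizedZ_le hsn h2s hε
  have hrate : 200 / √((n : ℝ) * (((n : ℝ) - s) / n) ^ k) ≤
      200 * Real.exp ((x + 1) / 2) * (n : ℝ) ^ (-((1 - α) / 2)) := by
    have h1 : √(Real.exp (-x - 1) * (n : ℝ) ^ (1 - α)) =
        Real.exp (-((x + 1) / 2)) * (n : ℝ) ^ ((1 - α) / 2) := by
      rw [Real.sqrt_mul (Real.exp_pos _).le, ← Real.exp_half, Real.sqrt_eq_rpow,
        ← Real.rpow_mul hn0.le]
      ring_nf
    have h2 := Real.sqrt_le_sqrt hmean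
    rw [h1] at h2
    calc _ ≤ 200 / (Real.exp (-((x + 1) / 2)) * (n : ℝ) ^ ((1 - α) / 2)) :=
          div_le_div_of_nonneg_left (by norm_num) (by positivity) h2
      _ = _ := by
          rw [Real.exp_neg, Real.rpow_neg hn0.le]
          field_simp
  refine ⟨fun hα3 => hd.trans (ENNReal.ofReal_le_ofReal (hrate.trans ?_)),
    fun _ => hd.trans (ENNReal.ofReal_le_ofReal hrate)⟩
  -- For α ≤ 1/3 one has α ≤ (1-α)/2, so the common rate is at most n^(-α); the logarithmic factor
  -- is at least 1 and is not needed.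
  refine mul_le_mul_of_nonneg_left ?_ (by positivity)
  calc (n : ℝ) ^ (-((1 - α) / 2)) ≤ (n : ℝ) ^ (-α) :=
        Real.rpow_le_rpow_of_exponent_le hn1 (by linarith)
    _ = 1 / (n : ℝ) ^ α := by rw [Real.rpow_neg hn0.le, one_div]
    _ ≤ √(Real.log n) / (n : ℝ) ^ α := by
        have := Real.one_le_sqrt.2 hlog
        gcongr
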